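/- Let $(\tilde M,J,g)$ be a locally conformally Kähler manifold: a complex manifold with a Hermitian metric $g$ such that every point has an open neighbourhood $U$ and a smooth function $\varphi:U\to\mathbb R$ for which $e^{-\varphi}g|_U$ is a Kähler metric, i.e. $J$ is parallel for its Levi-Civita connection. Let $\alpha$ be its Lee form, normalized so that $\alpha|_U=\tfrac12\,d\varphi$ for such $U,\varphi$ covering $\tilde M$ (so $d\alpha=0$ and $d\Omega=2\alpha\wedge\Omega$ for $\Omega(X,Y)=g(X,JY)$), and let $\alpha^{\#}$ be the Lee vector field, $g(\alpha^{\#},X)=\alpha(X)$. Let $M$ be a submanifold immersed in $\tilde M$, with the induced metric, also denoted $g$. Write $\xi^{\perp}$ for the component of $\xi$ normal to $M$, $h$ for the second fundamental form, and $A_\xi$ for the shape operator, $g(A_\xi X,Y)=g(h(X,Y),\xi)$; for $X$ tangent to $M$ write $JX=PX+FX$ with $PX$ tangent and $FX$ normal to $M$. Suppose that $M$ is pointwise semi-slant: $TM=\mathfrak D\oplus\mathfrak D^\theta$ is an orthogonal sum of smooth distributions with $J\mathfrak D=\mathfrak D$ and $P^2Z=-(\cos^2\theta)Z$ for $Z\in\mathfrak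 D^\theta$, where $\theta$ is a real-valued function on $M$; and suppose that $\cos^2\theta<1$ at every point where $\mathfrak D^\theta\neq0$. A distribution $\mathcal D$ on $M$ is called integrable if $[X,Y]\in\Gamma(\mathcal D)$ for all $X,Y\in\Gamma(\mathcal D)$. Then: (i) The holomorphic distribution $\mathfrak D$ is integrable if and only if $$h(JY,X)-h(JX,Y)=2\,g(JX,Y)\,(\alpha^{\#})^{\perp}\qquad\text{for all }X,Y\in\Gamma(\mathfrak D).$$ (ii) The slant distribution $\mathfrak D^\theta$ is integrable if and only if $$g(A_{FW}JX-A_{FPW}X,\,Z)=g(A_{FZ}JX-A_{FPZ}X,\,W)\qquad\text{for all }X\in\Gamma(\mathfrak D),\ Z,W\in\Gamma(\mathfrak D^\theta).$$ -/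

import Mathlib

set_option maxSynthPendingDepth 3

open Bundle VectorField
open scoped Manifold ContDiff Topology

noncomputable section

namespace LCK

/-! ### The Levi-Civita connection of a metric

`N` is a real manifold modelled on `V`, and a metric on `N` enters as the family `G` of its inner
products on the tangent spaces. The tangent space at `x` is `V`, read through the preferred chart at
`x`; tangent vectors at points `y` near `x` are read in that same chart through the trivialization
of the tangent bundle at `x`, which over `x` itself is the identity. -/

section Connection

variable {V : Type*} [NormedAddCommGroup V] [NormedSpace ℝ V]
  {N : Type*} [TopologicalSpace N] [ChartedSpace V N] [IsManifold 𝓘(ℝ, V) ∞ N]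

/-- The components at `y` of the metric `G` in the preferred chart at `x`. -/
def metricInChart (G : ∀ x : N, TangentSpace 𝓘(ℝ, V) x →L[ℝ] TangentSpace 𝓘(ℝ, V) x →L[ℝ] ℝ)
    (x y : N) : V →L[ℝ] V →L[ℝ] ℝ :=
  ContinuousLinearMap.precomp ℝ
      ((trivializationAt V (TangentSpace 𝓘(ℝ, V) : N → Type _) x).symmL ℝ y) ∘L G y ∘L
    (trivializationAt V (TangentSpace 𝓘(ℝ, V) : N → Type _) x).symmL ℝ y

/-- The derivative at `x` of the metric components in the preferred chart at `x`; the first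
argument is the direction of differentiation. -/
def metricDeriv (G : ∀ x : N, TangentSpace 𝓘(ℝ, V) x →L[ℝ] TangentSpace 𝓘(ℝ, V) x →L[ℝ] ℝ)
    (x : N) : V →L[ℝ] V →L[ℝ] V →L[ℝ] ℝ :=
  mvfderiv 𝓘(ℝ, V) (metricInChart G x) x

/-- Christoffel symbols of the first kind at `x`, in the preferred chart at `x`:
`[u, v; w] = (∂_u G(v, w) + ∂_v G(u, w) - ∂_w G(u, v)) / 2`. -/
def christoffelFirst (G : ∀ x : N, TangentSpace 𝓘(ℝ, V) x →L[ℝ] TangentSpace 𝓘(ℝ, V) x →L[ℝ] ℝ)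
    (x : N) : V →L[ℝ] V →L[ℝ] V →L[ℝ] ℝ :=
  let d := metricDeriv G x
  (1 / 2 : ℝ) • (d + d.flip
    - (ContinuousLinearMap.flipₗᵢ ℝ V V ℝ).toContinuousLinearEquiv.toContinuousLinearMap ∘L d.flip)

theorem christoffelFirst_apply
    (G : ∀ x : N, TangentSpace 𝓘(ℝ, V) x →L[ℝ] TangentSpace 𝓘(ℝ, V) x →L[ℝ] ℝ)
    (x : N) (u v w : V) :
    christoffelFirst G x u v w =
      (metricDeriv G x u v w + metricDeriv G x v u w - metricDeriv G x w u v) / 2 := by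
  simp [christoffelFirst]
  ring

/-- Christoffel symbols of the second kind at `x`, in the preferred chart at `x`: the last index
of the symbols of the first kind is raised with the metric. -/
def christoffel (G : ∀ x : N, TangentSpace 𝓘(ℝ, V) x →L[ℝ] TangentSpace 𝓘(ℝ, V) x →L[ℝ] ℝ)
    (x : N) : V →L[ℝ] V →L[ℝ] V :=
  ContinuousLinearMap.postcomp V (metricInChart G x x).inverse ∘L christoffelFirst G x

variable (W : Type*) [NormedAddCommGroup W] [NormedSpace ℝ W]
  {M : Type*} [TopologicalSpace M] [ChartedSpace W M] [IsManifold 𝓘(ℝ, W) ∞ M]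

/-- The Levi-Civita derivative of a vector field `Y` along a map `f : M → N`, at the point `p`:
in the preferred chart at `f p`, `u ↦ ∂_u Y + Γ(df u, Y)`. -/
def covDerivAlong (G : ∀ x : N, TangentSpace 𝓘(ℝ, V) x →L[ℝ] TangentSpace 𝓘(ℝ, V) x →L[ℝ] ℝ)
    (f : M → N) (Y : ∀ q : M, TangentSpace 𝓘(ℝ, V) (f q)) (p : M) :
    TangentSpace 𝓘(ℝ, W) p →L[ℝ] TangentSpace 𝓘(ℝ, V) (f p) :=
  (mvfderiv 𝓘(ℝ, W) (fun q => (trivializationAt V (TangentSpace 𝓘(ℝ, V) : N → Type _)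
      (f p)).continuousLinearMapAt ℝ (f q) (Y q)) p : W →L[ℝ] V)
    + (christoffel G (f p)).flip (Y p) ∘L (mfderiv 𝓘(ℝ, W) 𝓘(ℝ, V) f p : W →L[ℝ] V)

/-- The Levi-Civita connection `∇` of the metric `G`: `leviCivita G Y x u` is `∇_u Y`. -/
def leviCivita (G : ∀ x : N, TangentSpace 𝓘(ℝ, V) x →L[ℝ] TangentSpace 𝓘(ℝ, V) x →L[ℝ] ℝ)
    (Y : ∀ x : N, TangentSpace 𝓘(ℝ, V) x) (x : N) :
    TangentSpace 𝓘(ℝ, V) x →L[ℝ] TangentSpace 𝓘(ℝ, V) x :=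
  covDerivAlong V G id Y x

/-- The Hessian `∇df` of a map `f : M → N` in the preferred charts at `p` and `f p`:
`(u, v) ↦ ∂_u ∂_v f + Γ(df u, df v)`. -/
def hessian (G : ∀ x : N, TangentSpace 𝓘(ℝ, V) x →L[ℝ] TangentSpace 𝓘(ℝ, V) x →L[ℝ] ℝ)
    (f : M → N) (p : M) :
    TangentSpace 𝓘(ℝ, W) p →L[ℝ] TangentSpace 𝓘(ℝ, W) p →L[ℝ] TangentSpace 𝓘(ℝ, V) (f p) :=
  let df : W →L[ℝ] V := mfderiv 𝓘(ℝ, W) 𝓘(ℝ, V) f p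
  let d2f : W →L[ℝ] W →L[ℝ] V :=
    mvfderiv 𝓘(ℝ, W) (inTangentCoordinates 𝓘(ℝ, W) 𝓘(ℝ, V) id f
      (fun q => mfderiv 𝓘(ℝ, W) 𝓘(ℝ, V) f q) p) p
  let Γ : W →L[ℝ] W →L[ℝ] V := ContinuousLinearMap.precomp V df ∘L christoffel G (f p) ∘L df
  d2f + Γ

end Connection

/-! ### Extrinsic geometry of an immersion into a Riemannian manifold -/

section Immersion

variable (W : Type*) [NormedAddCommGroup W] [NormedSpace ℝ W]
  {V : Type*} [NormedAddCommGroup V] [NormedSpace ℝ V]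
  {N : Type*} [TopologicalSpace N] [ChartedSpace V N] [IsManifold 𝓘(ℝ, V) ∞ N]
  (g : ContMDiffRiemannianMetric 𝓘(ℝ, V) ∞ V (TangentSpace 𝓘(ℝ, V) : N → Type _))
  {M : Type*} [TopologicalSpace M] [ChartedSpace W M] [IsManifold 𝓘(ℝ, W) ∞ M]
  (f : M → N) (p : M)

/-- The metric induced on `M`: `(u, v) ↦ g(df u, df v)`. -/
def inducedMetric : TangentSpace 𝓘(ℝ, W) p →L[ℝ] TangentSpace 𝓘(ℝ, W) p →L[ℝ] ℝ :=
  ContinuousLinearMap.precomp ℝ (mfderiv 𝓘(ℝ, W) 𝓘(ℝ, V) f p) ∘L g.inner (f p) ∘L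
    mfderiv 𝓘(ℝ, W) 𝓘(ℝ, V) f p

/-- The tangential part of `ξ`: the vector `u` tangent to `M` with `g(df u, df v) = g(ξ, df v)`
for all `v` tangent to `M`. -/
def tangentialPart : TangentSpace 𝓘(ℝ, V) (f p) →L[ℝ] TangentSpace 𝓘(ℝ, W) p :=
  (inducedMetric W g f p).inverse ∘L
    ContinuousLinearMap.precomp ℝ (mfderiv 𝓘(ℝ, W) 𝓘(ℝ, V) f p) ∘L g.inner (f p)

/-- The normal part `ξ - df(tangential part of ξ)` of `ξ`. -/
def normalPart : TangentSpace 𝓘(ℝ, V) (f p) →L[ℝ] TangentSpace 𝓘(ℝ, V) (f p) :=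
  ContinuousLinearMap.id ℝ _ - mfderiv 𝓘(ℝ, W) 𝓘(ℝ, V) f p ∘L tangentialPart W g f p

/-- The second fundamental form `h`, the normal part of the Hessian of the immersion; see
`gauss_formula` for its description by covariant derivatives of vector fields. -/
def secondFundamentalForm :
    TangentSpace 𝓘(ℝ, W) p →L[ℝ] TangentSpace 𝓘(ℝ, W) p →L[ℝ] TangentSpace 𝓘(ℝ, V) (f p) :=
  ContinuousLinearMap.postcomp _ (normalPart W g f p) ∘L hessian W g.inner f p

/-- The shape operator `A_ξ`: `g(A_ξ u, v) = g(h(u, v), ξ)` for all `v` tangent to `M`. -/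
def shapeOperator (ξ : TangentSpace 𝓘(ℝ, V) (f p)) :
    TangentSpace 𝓘(ℝ, W) p →L[ℝ] TangentSpace 𝓘(ℝ, W) p :=
  (inducedMetric W g f p).inverse ∘L
    ContinuousLinearMap.postcomp _ (g.inner (f p) ξ) ∘L secondFundamentalForm W g f p

end Immersion

section Gauss

variable {V : Type*} [NormedAddCommGroup V] [NormedSpace ℝ V]
  {N : Type*} [TopologicalSpace N] [ChartedSpace V N] [IsManifold 𝓘(ℝ, V) ∞ N]
  (W : Type*) [NormedAddCommGroup W] [NormedSpace ℝ W]
  {M : Type*} [TopologicalSpace M] [ChartedSpace W M] [IsManifold 𝓘(ℝ, W) ∞ M]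

set_option linter.unusedSectionVars false in
theorem mvfderiv_clm_apply {X : M → (W →L[ℝ] V)} {Z : M → W} {p : M}
  (hX : MDifferentiableAt 𝓘(ℝ, W) 𝓘(ℝ, W →L[ℝ] V) X p) (hZ : MDifferentiableAt 𝓘(ℝ, W) 𝓘(ℝ, W) Z p) (u : TangentSpace 𝓘(ℝ, W) p) :
  mvfderiv 𝓘(ℝ, W) (fun q => X q (Z q)) p u =
   (mvfderiv 𝓘(ℝ, W) X p u) (Z p) + X p (mvfderiv 𝓘(ℝ, W) Z p u) := by
  have hXZ : MDifferentiableAt 𝓘(ℝ, W) 𝓘(ℝ, V) (fun q => X q (Z q)) p := hX.clm_apply hZ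
  let a : W := extChartAt 𝓘(ℝ, W) p p
  let Xc : W → W →L[ℝ] V := X ∘ (extChartAt 𝓘(ℝ, W) p).symm
  let Zc : W → W := Z ∘ (extChartAt 𝓘(ℝ, W) p).symm
  let dX : W →L[ℝ] W →L[ℝ] V := mfderiv 𝓘(ℝ, W) 𝓘(ℝ, W →L[ℝ] V) X p
  let dZ : W →L[ℝ] W := mfderiv 𝓘(ℝ, W) 𝓘(ℝ, W) Z p
  let dXZ : W →L[ℝ] V := mfderiv 𝓘(ℝ, W) 𝓘(ℝ, V) (fun q => X q (Z q)) p
  have e1 : HasFDerivWithinAt Xc dX Set.univ a := by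
    have := hX.hasMFDerivAt.2
    rwa [modelWithCornersSelf_coe, Set.range_id] at this
  have e2 : HasFDerivWithinAt Zc dZ Set.univ a := by
    have := hZ.hasMFDerivAt.2
    rwa [modelWithCornersSelf_coe, Set.range_id] at this
  have e3 : HasFDerivWithinAt (fun y => Xc y (Zc y)) dXZ Set.univ a := by
    have := hXZ.hasMFDerivAt.2
    rwa [modelWithCornersSelf_coe, Set.range_id] at this
  rw [hasFDerivWithinAt_univ] at e1 e2 e3
  have h := congrArg (fun L => L u) (e3.unique (e1.clm_apply e2))
  have ha : (extChartAt 𝓘(ℝ, W) p).symm a = p := by simp [a]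
  have hXa : Xc a = X p := by simp only [Xc, Function.comp_apply, ha]
  have hZa : Zc a = Z p := by simp only [Zc, Function.comp_apply, ha]
  rw [hXa, hZa] at h
  exact h.trans (add_comm _ _)

theorem symmL_self (x : N) : (trivializationAt V (TangentSpace 𝓘(ℝ, V) : N → Type _) x).symmL ℝ x = ContinuousLinearMap.id ℝ V := by
  rw [TangentBundle.symmL_trivializationAt_eq_core (by simp)]
  ext v
  exact (tangentBundleCore 𝓘(ℝ, V) N).coordChange_self _ x (by simp) v

theorem continuousLinearMapAt_self (x : N) : (trivializationAt V (TangentSpace 𝓘(ℝ, V) : N → Type _) x).continuousLinearMapAt ℝ x = ContinuousLinearMap.id ℝ V := by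
  rw [TangentBundle.continuousLinearMapAt_trivializationAt_eq_core (by simp)]
  ext v
  exact (tangentBundleCore 𝓘(ℝ, V) N).coordChange_self _ x (by simp) v

/-- Gauss' formula: for a vector field `Y` on `M`, `h(u, Y)` is the normal part of the Levi-Civita
derivative `∇_u (df Y)` along the immersion. In particular the Hessian in the definition of `h`
computes the usual second fundamental form. -/
theorem gauss_formula [FiniteDimensional ℝ W] (g : ContMDiffRiemannianMetric 𝓘(ℝ, V) ∞ V (TangentSpace 𝓘(ℝ, V) : N → Type _))
  (f : M → N) (p : M) (hf : ContMDiffAt 𝓘(ℝ, W) 𝓘(ℝ, V) ∞ f p)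
  (hinj : Function.Injective (mfderiv 𝓘(ℝ, W) 𝓘(ℝ, V) f p))
  (Y : ∀ q : M, TangentSpace 𝓘(ℝ, W) q)
  (hY : MDifferentiableAt 𝓘(ℝ, W) 𝓘(ℝ, W).tangent (fun q => (⟨q, Y q⟩ : TangentBundle 𝓘(ℝ, W) M)) p)
  (u : TangentSpace 𝓘(ℝ, W) p) :
  secondFundamentalForm W g f p u (Y p) =
  normalPart W g f p (covDerivAlong W g.inner f (fun q => mfderiv 𝓘(ℝ, W) 𝓘(ℝ, V) f q (Y q)) p u) := by
  have hn : ∀ w, normalPart W g f p (mfderiv 𝓘(ℝ, W) 𝓘(ℝ, V) f p w) = 0 := by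
    intro w
    have hB : (inducedMetric W g f p).IsInvertible := by
      have hi : Function.Injective (inducedMetric W g f p) := by
        rw [injective_iff_map_eq_zero]
        intro a ha
        by_contra hne
        have := g.pos (f p) (mfderiv 𝓘(ℝ, W) 𝓘(ℝ, V) f p a) (fun h0 => hne (hinj (by simpa using h0)))
        have h2 : inducedMetric W g f p a a = 0 := by rw [ha]; rfl
        exact this.ne' h2
      let B : W →L[ℝ] W →L[ℝ] ℝ := inducedMetric W g f p
      have hr : Module.finrank ℝ W = Module.finrank ℝ (W →L[ℝ] ℝ) := by
        rw [← (LinearMap.toContinuousLinearMap (𝕜 := ℝ) (E := W) (F' := ℝ)).finrank_eq]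
        exact (Subspace.dual_finrank_eq).symm
      let e := (LinearEquiv.ofInjectiveOfFinrankEq (B : W →ₗ[ℝ] (W →L[ℝ] ℝ)) hi hr).toContinuousLinearEquiv
      exact ⟨e, by ext; rfl⟩
    have : tangentialPart W g f p (mfderiv 𝓘(ℝ, W) 𝓘(ℝ, V) f p w) = w := by
      change (inducedMetric W g f p).inverse (inducedMetric W g f p w) = w
      exact hB.inverse_apply_eq.2 rfl
    change mfderiv 𝓘(ℝ, W) 𝓘(ℝ, V) f p w - mfderiv 𝓘(ℝ, W) 𝓘(ℝ, V) f p (tangentialPart W g f p (mfderiv 𝓘(ℝ, W) 𝓘(ℝ, V) f p w)) = 0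
    rw [this, sub_self]
  let Yc : M → W := fun q => (trivializationAt W (TangentSpace 𝓘(ℝ, W) : M → Type _) p).continuousLinearMapAt ℝ q (Y q)
  let Df : M → (W →L[ℝ] V) := inTangentCoordinates 𝓘(ℝ, W) 𝓘(ℝ, V) id f (fun q => mfderiv 𝓘(ℝ, W) 𝓘(ℝ, V) f q) p
  have hDf : MDifferentiableAt 𝓘(ℝ, W) 𝓘(ℝ, W →L[ℝ] V) Df p :=
    (hf.mfderiv_const (m := 1) (by rw [one_add_one_eq_two]; exact ENat.LEInfty.out)).mdifferentiableAt one_ne_zero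
  have hbase : ∀ᶠ q in 𝓝 p, q ∈ (trivializationAt W (TangentSpace 𝓘(ℝ, W) : M → Type _) p).baseSet :=
      (trivializationAt W (TangentSpace 𝓘(ℝ, W) : M → Type _) p).open_baseSet.mem_nhds (mem_baseSet_trivializationAt W _ p)
  have hYc : MDifferentiableAt 𝓘(ℝ, W) 𝓘(ℝ, W) Yc p := by
    have h := (mdifferentiableAt_section (IB := 𝓘(ℝ, W)) (F := W) (E := (TangentSpace 𝓘(ℝ, W) : M → Type _)) (fun q => Y q)).1 hY
    refine h.congr_of_eventuallyEq ?_
    filter_upwards [hbase] with q hq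
    exact Trivialization.continuousLinearMapAt_apply_of_mem ℝ _ hq _
  have heq : (fun q => (trivializationAt V (TangentSpace 𝓘(ℝ, V) : N → Type _)
      (f p)).continuousLinearMapAt ℝ (f q) (mfderiv 𝓘(ℝ, W) 𝓘(ℝ, V) f q (Y q))) =ᶠ[𝓝 p] fun q => Df q (Yc q) := by
    filter_upwards [hbase] with q hq
    simp only [Df, Yc, inTangentCoordinates, ContinuousLinearMap.inCoordinates, ContinuousLinearMap.comp_apply]
    simp only [id]
    rw [Trivialization.symmL_continuousLinearMapAt _ hq]
  have hYp : Yc p = Y p := by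
    simp only [Yc]
    rw [continuousLinearMapAt_self]
    rfl
  have hDp : Df p = mfderiv 𝓘(ℝ, W) 𝓘(ℝ, V) f p := by
    simp only [Df, inTangentCoordinates, ContinuousLinearMap.inCoordinates, id]
    rw [continuousLinearMapAt_self, symmL_self]
    rfl
  have key : covDerivAlong W g.inner f (fun q => mfderiv 𝓘(ℝ, W) 𝓘(ℝ, V) f q (Y q)) p u
     = hessian W g.inner f p u (Y p) + mfderiv 𝓘(ℝ, W) 𝓘(ℝ, V) f p (mvfderiv 𝓘(ℝ, W) Yc p u) := by
    have h1 := mvfderiv_clm_apply W hDf hYc u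
    unfold mvfderiv at h1
    rw [← heq.mfderiv_eq, hYp, hDp] at h1
    have h2 : ∀ a b c d : V, a = b + c → a + d = (b + d) + c := by
      rintro a b c d rfl; abel
    exact h2 _ _ _ _ h1
  rw [key]
  exact ((map_add _ _ _).trans ((congrArg _ (hn _)).trans (add_zero _))).symm

end Gauss

/-! ### Locally conformally Kähler manifolds

A complex manifold is a manifold with charts in a complex vector space `E` and holomorphic
transition maps; its real tangent space at `x` is `E`, and `J` is multiplication by the imaginary
unit, which does not depend on the chart since transition maps have complex linear derivatives. -/

section Ambient

variable {E : Type*} [NormedAddCommGroup E] [NormedSpace ℂ E]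
  {N : Type*} [TopologicalSpace N] [ChartedSpace E N]

/-- The complex structure `J` on the tangent space at `x`. -/
def J (x : N) : TangentSpace 𝓘(ℝ, E) x →L[ℝ] TangentSpace 𝓘(ℝ, E) x :=
  (Complex.I • ContinuousLinearMap.id ℝ E : E →L[ℝ] E)

variable [IsManifold 𝓘(ℝ, E) ∞ N]

/-- `∇J = 0` on the set `U`, for the Levi-Civita connection `∇` of the metric `G`:
`∇_u (J Y) = J ∇_u Y` for all vector fields `Y`. -/
def IsParallelJOn (G : ∀ x : N, TangentSpace 𝓘(ℝ, E) x →L[ℝ] TangentSpace 𝓘(ℝ, E) x →L[ℝ] ℝ)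
    (U : Set N) : Prop :=
  ∀ x ∈ U, ∀ Y : ∀ y : N, TangentSpace 𝓘(ℝ, E) y,
    ContMDiffAt 𝓘(ℝ, E) 𝓘(ℝ, E).tangent ∞ (fun y => (⟨y, Y y⟩ : TangentBundle 𝓘(ℝ, E) N)) x →
    ∀ u : TangentSpace 𝓘(ℝ, E) x,
      leviCivita G (fun y => J y (Y y)) x u = J x (leviCivita G Y x u)

/-- `(N, J, g)` is a locally conformally Kähler manifold with Lee form `α`: the metric `g` is
Hermitian, and near every point there is a smooth function `φ` such that `exp (-φ) g` is a Kähler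
metric and `α = dφ / 2`. The factor `1 / 2` is the normalization `dΩ = 2 α ∧ Ω` of the Lee form. -/
structure IsLCKWithLeeForm
    (g : ContMDiffRiemannianMetric 𝓘(ℝ, E) ∞ E (TangentSpace 𝓘(ℝ, E) : N → Type _))
    (α : ∀ x : N, TangentSpace 𝓘(ℝ, E) x →L[ℝ] ℝ) : Prop where
  hermitian : ∀ (x : N) (u v : TangentSpace 𝓘(ℝ, E) x),
    g.inner x (J x u) (J x v) = g.inner x u v
  locally_conformal : ∀ x : N, ∃ (U : Set N) (φ : N → ℝ), IsOpen U ∧ x ∈ U ∧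
    ContMDiffOn 𝓘(ℝ, E) 𝓘(ℝ, ℝ) ∞ φ U ∧
    IsParallelJOn (fun y => Real.exp (-φ y) • g.inner y) U ∧
    ∀ y ∈ U, α y = (1 / 2 : ℝ) • mvfderiv 𝓘(ℝ, E) φ y

/-- The vector field `α^#` dual to the 1-form `α`: `g(α^#, v) = α(v)`. -/
def sharp (g : ContMDiffRiemannianMetric 𝓘(ℝ, E) ∞ E (TangentSpace 𝓘(ℝ, E) : N → Type _))
    (α : ∀ x : N, TangentSpace 𝓘(ℝ, E) x →L[ℝ] ℝ) (x : N) : TangentSpace 𝓘(ℝ, E) x :=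
  (g.inner x).inverse (α x)

end Ambient

/-! ### Distributions -/

section Distribution

variable {W : Type*} [NormedAddCommGroup W] [NormedSpace ℝ W]
  {M : Type*} [TopologicalSpace M] [ChartedSpace W M] [IsManifold 𝓘(ℝ, W) ∞ M]

/-- A smooth distribution: locally spanned by a smooth frame of linearly independent fields. -/
def IsSmoothDistribution (D : ∀ p : M, Submodule ℝ (TangentSpace 𝓘(ℝ, W) p)) : Prop :=
  ∀ p : M, ∃ (k : ℕ) (X : Fin k → ∀ q : M, TangentSpace 𝓘(ℝ, W) q) (U : Set M),
    IsOpen U ∧ p ∈ U ∧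
    (∀ i, ContMDiffOn 𝓘(ℝ, W) 𝓘(ℝ, W).tangent ∞
      (fun q => (⟨q, X i q⟩ : TangentBundle 𝓘(ℝ, W) M)) U) ∧
    ∀ q ∈ U, LinearIndependent ℝ (fun i => X i q) ∧
      Submodule.span ℝ (Set.range fun i => X i q) = D q

/-- `X ∈ Γ(D)`: `X` is a smooth vector field on `M` with values in the distribution `D`. -/
def IsSection (D : ∀ p : M, Submodule ℝ (TangentSpace 𝓘(ℝ, W) p))
    (X : ∀ p : M, TangentSpace 𝓘(ℝ, W) p) : Prop :=
  ContMDiff 𝓘(ℝ, W) 𝓘(ℝ, W).tangent ∞ (fun p => (⟨p, X p⟩ : TangentBundle 𝓘(ℝ, W) M)) ∧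
    ∀ p, X p ∈ D p

/-- A distribution `D` is integrable if `[X, Y] ∈ Γ(D)` for all `X, Y ∈ Γ(D)`. -/
def IsIntegrable (D : ∀ p : M, Submodule ℝ (TangentSpace 𝓘(ℝ, W) p)) : Prop :=
  ∀ X Y : ∀ p : M, TangentSpace 𝓘(ℝ, W) p, IsSection D X → IsSection D Y →
    ∀ p, mlieBracket 𝓘(ℝ, W) X Y p ∈ D p

end Distribution

/-! ### Pointwise semi-slant submanifolds -/

section SemiSlant

variable {W : Type*} [NormedAddCommGroup W] [NormedSpace ℝ W]
  {E : Type*} [NormedAddCommGroup E] [NormedSpace ℂ E]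
  {N : Type*} [TopologicalSpace N] [ChartedSpace E N] [IsManifold 𝓘(ℝ, E) ∞ N]
  (g : ContMDiffRiemannianMetric 𝓘(ℝ, E) ∞ E (TangentSpace 𝓘(ℝ, E) : N → Type _))
  {M : Type*} [TopologicalSpace M] [ChartedSpace W M] [IsManifold 𝓘(ℝ, W) ∞ M]
  (f : M → N)

/-- `P u`, the tangential part of `J u`, for `u` tangent to `M`. If `J u` is itself tangent to `M`,
then `P u` is `J u` as a vector tangent to `M`. -/
def P (p : M) : TangentSpace 𝓘(ℝ, W) p →L[ℝ] TangentSpace 𝓘(ℝ, W) p :=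
  tangentialPart W g f p ∘L J (f p) ∘L mfderiv 𝓘(ℝ, W) 𝓘(ℝ, E) f p

/-- `F u`, the normal part of `J u`, for `u` tangent to `M`. -/
def F (p : M) : TangentSpace 𝓘(ℝ, W) p →L[ℝ] TangentSpace 𝓘(ℝ, E) (f p) :=
  normalPart W g f p ∘L J (f p) ∘L mfderiv 𝓘(ℝ, W) 𝓘(ℝ, E) f p

/-- `M`, immersed by `f`, is a pointwise semi-slant submanifold with holomorphic distribution `D`
and pointwise slant distribution `Dθ` of slant function `θ`: `TM` is the orthogonal sum of `D` and
`Dθ`, `J D = D`, and `P² = -(cos² θ) I` on `Dθ` (the angle between `J Z` and `Dθ` is `θ p` for all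
nonzero `Z` in `Dθ p`). -/
structure IsPointwiseSemiSlant (D Dθ : ∀ p : M, Submodule ℝ (TangentSpace 𝓘(ℝ, W) p))
    (θ : M → ℝ) : Prop where
  smooth_holomorphic : IsSmoothDistribution D
  smooth_slant : IsSmoothDistribution Dθ
  orthogonal : ∀ p, ∀ u ∈ D p, ∀ v ∈ Dθ p, inducedMetric W g f p u v = 0
  span : ∀ p, D p ⊔ Dθ p = ⊤
  holomorphic : ∀ p,
    (fun u => J (f p) (mfderiv 𝓘(ℝ, W) 𝓘(ℝ, E) f p u)) '' (D p : Set (TangentSpace 𝓘(ℝ, W) p))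
      = mfderiv 𝓘(ℝ, W) 𝓘(ℝ, E) f p '' (D p : Set (TangentSpace 𝓘(ℝ, W) p))
  slant : ∀ p, ∀ z ∈ Dθ p, P g f p (P g f p z) = -(Real.cos (θ p) ^ 2) • z

end SemiSlant

end LCK

end

/-! Near each point `exp (-φ) g` is Kähler, so its Christoffel symbols commute with `J`. Comparing
them with those of `g` turns `∇J` into an expression in the Lee form: for a field `A` along the
immersion, g(∇_u(JA), w) + g(∇_u A, Jw) = α(JA)g(u,w) - α(w)g(u,JA) + α(A)g(u,Jw) - α(Jw)g(u,A),
which is `chartCovDeriv_J`. Everything else follows from this identity together with the vanishing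
of the torsion (`chartCovDeriv_sub_chartCovDeriv`) and of `∇g` (`chartDeriv_inner`).

(i) For X, Y in `D` and normal w, subtracting the identities for ∇_X(JY) and ∇_Y(JX) gives F[X,Y] =
h(JY,X) - h(JX,Y) - 2g(JX,Y)(α^#)^⊥ (`chartF_mlieBracket`). Since cos²θ < 1, `F` is injective on
`Dθ`, so `D` is exactly the kernel of `F` and the right side vanishes iff [X,Y] lies in `D`.

(ii) For X in `D` and Y, Z in `Dθ`, the identity gives g(A_{FY}JX - A_{FPY}X, Z) = sin²θ (g(∇_Z X,
Y) - α(X)g(Z,Y)). The Lee term is symmetric in Y and Z, so antisymmetrizing leaves -sin²θ g(X,[Z,Y])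
(`inducedForm_chartShape_sub_sub`). As `Dθ` is the orthogonal complement of `D`, this decides
whether [Z,Y] lies in `Dθ`.

All computations at a point take place in the preferred charts there. Definitions such as
`pushforward`, `fieldValue` and `chartCovDeriv` only retype tangent data in the model spaces, where
addition and rewriting do not meet dependent types; they unfold definitionally to the original
objects. -/

noncomputable section

namespace LCK

/-! ### Positive definite bilinear forms. -/

section LinearAlgebra

variable {V : Type*} [NormedAddCommGroup V] [NormedSpace ℝ V]

theorem isInvertible_of_posDef [FiniteDimensional ℝ V] (B : V →L[ℝ] V →L[ℝ] ℝ)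
    (hB : ∀ v, v ≠ 0 → 0 < B v v) : B.IsInvertible := by
  have hi : Function.Injective B := by
    rw [injective_iff_map_eq_zero]
    intro a ha
    by_contra hne
    have h := hB a hne
    rw [ha] at h
    exact lt_irrefl _ h
  have hr : Module.finrank ℝ V = Module.finrank ℝ (V →L[ℝ] ℝ) := by
    rw [← (LinearMap.toContinuousLinearMap (𝕜 := ℝ) (E := V) (F' := ℝ)).finrank_eq]
    exact (Subspace.dual_finrank_eq).symm
  exact ⟨(LinearEquiv.ofInjectiveOfFinrankEq
    (B : V →ₗ[ℝ] (V →L[ℝ] ℝ)) hi hr).toContinuousLinearEquiv, by ext; rfl⟩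

theorem apply_inverse_apply {B : V →L[ℝ] V →L[ℝ] ℝ} (hB : B.IsInvertible) (φ : V →L[ℝ] ℝ) (v : V) :
    B (B.inverse φ) v = φ v := by
  rw [hB.self_apply_inverse]

theorem eq_of_posDef {B : V →L[ℝ] V →L[ℝ] ℝ}
    (hB : ∀ v, v ≠ 0 → 0 < B v v) {u v : V} (h : ∀ w, B u w = B v w) : u = v := by
  by_contra hne
  have h' := hB (u - v) (sub_ne_zero.2 hne)
  have : B (u - v) (u - v) = 0 := by
    rw [map_sub (B (u - v)), map_sub B]
    simp [h]
  exact h'.ne' this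

end LinearAlgebra

/-! ### Fields, differentials and metrics in the preferred chart. -/

section Components

variable {V : Type*} [NormedAddCommGroup V] [NormedSpace ℝ V]
  {N : Type*} [TopologicalSpace N] [ChartedSpace V N] [IsManifold 𝓘(ℝ, V) ∞ N]
  {W : Type*} [NormedAddCommGroup W] [NormedSpace ℝ W]
  {M : Type*} [TopologicalSpace M] [ChartedSpace W M] [IsManifold 𝓘(ℝ, W) ∞ M]

/-- The components near `p` of a vector field `A` along `f`, in the preferred chart at `f p`. -/
def components (f : M → N) (A : ∀ q : M, TangentSpace 𝓘(ℝ, V) (f q)) (p q : M) : V :=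
  (trivializationAt V (TangentSpace 𝓘(ℝ, V) : N → Type _) (f p)).continuousLinearMapAt ℝ (f q) (A q)

variable (V W) in
/-- The components near `p` of the derivative of `f`, in the preferred charts at `p` and `f p`. -/
def derivComponents (f : M → N) (p : M) : M → W →L[ℝ] V :=
  inTangentCoordinates 𝓘(ℝ, W) 𝓘(ℝ, V) id f (fun q => mfderiv 𝓘(ℝ, W) 𝓘(ℝ, V) f q) p

theorem eventually_mem_baseSet (x : N) :
    ∀ᶠ y in 𝓝 x, y ∈ (trivializationAt V (TangentSpace 𝓘(ℝ, V) : N → Type _) x).baseSet :=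
  (trivializationAt V (TangentSpace 𝓘(ℝ, V) : N → Type _) x).open_baseSet.mem_nhds
    (mem_baseSet_trivializationAt V _ x)

omit [TopologicalSpace M] in
theorem components_self (f : M → N) (A : ∀ q : M, TangentSpace 𝓘(ℝ, V) (f q)) (p : M) :
    components f A p p = A p := by
  unfold components
  rw [continuousLinearMapAt_self]
  rfl

theorem derivComponents_self (f : M → N) (p : M) :
    derivComponents V W f p p = (mfderiv 𝓘(ℝ, W) 𝓘(ℝ, V) f p : W →L[ℝ] V) := by
  simp only [derivComponents, inTangentCoordinates, ContinuousLinearMap.inCoordinates, id]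
  rw [continuousLinearMapAt_self, symmL_self]
  rfl

theorem components_mfderiv (f : M → N) (p : M) (Y : ∀ q : M, TangentSpace 𝓘(ℝ, W) q) :
    components f (fun q => mfderiv 𝓘(ℝ, W) 𝓘(ℝ, V) f q (Y q)) p
      =ᶠ[𝓝 p] fun q => derivComponents V W f p q (components id Y p q) := by
  -- Off the base set the maps of the trivialization are zero by default, so the identity is only
  -- local.
  filter_upwards [eventually_mem_baseSet (V := W) p] with q hq
  simp only [components, derivComponents, inTangentCoordinates, ContinuousLinearMap.inCoordinates,
    ContinuousLinearMap.comp_apply]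
  simp only [id]
  rw [Trivialization.symmL_continuousLinearMapAt _ hq]

theorem mdifferentiableAt_components_id {Y : ∀ q : M, TangentSpace 𝓘(ℝ, W) q} {p : M}
    (hY : ContMDiffAt 𝓘(ℝ, W) 𝓘(ℝ, W).tangent ∞
      (fun q => (⟨q, Y q⟩ : TangentBundle 𝓘(ℝ, W) M)) p) :
    MDifferentiableAt 𝓘(ℝ, W) 𝓘(ℝ, W) (components id Y p) p := by
  have h := (mdifferentiableAt_section (IB := 𝓘(ℝ, W)) (F := W)
    (E := (TangentSpace 𝓘(ℝ, W) : M → Type _)) (fun q => Y q)).1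
    (hY.mdifferentiableAt (by simp))
  refine h.congr_of_eventuallyEq ?_
  filter_upwards [eventually_mem_baseSet (V := W) p] with q hq
  exact Trivialization.continuousLinearMapAt_apply_of_mem ℝ _ hq _

theorem mdifferentiableAt_derivComponents {f : M → N} {p : M}
    (hf : ContMDiffAt 𝓘(ℝ, W) 𝓘(ℝ, V) ∞ f p) :
    MDifferentiableAt 𝓘(ℝ, W) 𝓘(ℝ, W →L[ℝ] V) (derivComponents V W f p) p :=
  (hf.mfderiv_const (m := 1)
    (by rw [one_add_one_eq_two]; exact ENat.LEInfty.out)).mdifferentiableAt one_ne_zero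

theorem mdifferentiableAt_components_mfderiv {f : M → N} {p : M}
    (hf : ContMDiffAt 𝓘(ℝ, W) 𝓘(ℝ, V) ∞ f p) {Y : ∀ q : M, TangentSpace 𝓘(ℝ, W) q}
    (hY : MDifferentiableAt 𝓘(ℝ, W) 𝓘(ℝ, W) (components id Y p) p) :
    MDifferentiableAt 𝓘(ℝ, W) 𝓘(ℝ, V)
      (components f (fun q => mfderiv 𝓘(ℝ, W) 𝓘(ℝ, V) f q (Y q)) p) p :=
  ((mdifferentiableAt_derivComponents hf).clm_apply hY).congr_of_eventuallyEq
    (components_mfderiv f p Y)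

theorem metricInChart_apply
    (G : ∀ x : N, TangentSpace 𝓘(ℝ, V) x →L[ℝ] TangentSpace 𝓘(ℝ, V) x →L[ℝ] ℝ) (x y : N)
    (u v : V) : metricInChart G x y u v =
      G y ((trivializationAt V (TangentSpace 𝓘(ℝ, V) : N → Type _) x).symmL ℝ y u)
        ((trivializationAt V (TangentSpace 𝓘(ℝ, V) : N → Type _) x).symmL ℝ y v) := rfl

theorem metricInChart_self
    (G : ∀ x : N, TangentSpace 𝓘(ℝ, V) x →L[ℝ] TangentSpace 𝓘(ℝ, V) x →L[ℝ] ℝ) (x : N) :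
    metricInChart G x x = (G x : V →L[ℝ] V →L[ℝ] ℝ) := by
  ext u v
  rw [metricInChart_apply, symmL_self]
  rfl

theorem metricInChart_components
    (G : ∀ x : N, TangentSpace 𝓘(ℝ, V) x →L[ℝ] TangentSpace 𝓘(ℝ, V) x →L[ℝ] ℝ) {f : M → N} {p : M}
    (hf : ContinuousAt f p) (A B : ∀ q : M, TangentSpace 𝓘(ℝ, V) (f q)) :
    (fun q => metricInChart G (f p) (f q) (components f A p q) (components f B p q))
      =ᶠ[𝓝 p] fun q => G (f q) (A q) (B q) := by
  filter_upwards [hf.eventually (eventually_mem_baseSet (V := V) (f p))] with q hq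
  rw [metricInChart_apply]
  simp only [components]
  rw [Trivialization.symmL_continuousLinearMapAt _ hq, Trivialization.symmL_continuousLinearMapAt _ hq]

/-- Smoothness of the metric is smoothness of a section of a hom bundle; over the base set its
coordinates there are the components of `metricInChart`. -/
theorem mdifferentiableAt_metricInChart
    (g : ContMDiffRiemannianMetric 𝓘(ℝ, V) ∞ V (TangentSpace 𝓘(ℝ, V) : N → Type _)) (x : N) :
    MDifferentiableAt 𝓘(ℝ, V) 𝓘(ℝ, V →L[ℝ] V →L[ℝ] ℝ) (metricInChart g.inner x) x := by
  have h := ((contMDiffAt_hom_bundle _).1 (g.contMDiff x)).2.mdifferentiableAt (by simp)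
  refine h.congr_of_eventuallyEq ?_
  filter_upwards [eventually_mem_baseSet (V := V) x] with y hy
  ext u v
  rw [metricInChart_apply]
  refine Eq.trans ?_ (inCoordinates_apply_eq₂ (E₃ := fun _ : N => ℝ) hy hy (by simp)).symm
  rw [← Trivialization.symmL_apply (R := ℝ) _ hy, ← Trivialization.symmL_apply (R := ℝ) _ hy]
  simp

end Components

/-! ### Differentiation of vector-valued functions in a chart. -/

section Calculus

variable {W : Type*} [NormedAddCommGroup W] [NormedSpace ℝ W]
  {M : Type*} [TopologicalSpace M] [ChartedSpace W M]
  {F₁ : Type*} [NormedAddCommGroup F₁] [NormedSpace ℝ F₁]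
  {F₂ : Type*} [NormedAddCommGroup F₂] [NormedSpace ℝ F₂]

variable (W) in
/-- The derivative of a vector-valued function, read in the preferred chart. -/
def chartDeriv (h : M → F₁) (p : M) : W →L[ℝ] F₁ := mvfderiv 𝓘(ℝ, W) h p

theorem hasFDerivAt_comp_extChartAt_symm {h : M → F₁} {p : M}
    (hh : MDifferentiableAt 𝓘(ℝ, W) 𝓘(ℝ, F₁) h p) :
    HasFDerivAt (h ∘ (extChartAt 𝓘(ℝ, W) p).symm) (chartDeriv W h p)
      (extChartAt 𝓘(ℝ, W) p p) := by
  have h' : HasFDerivWithinAt (h ∘ (extChartAt 𝓘(ℝ, W) p).symm)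
      (chartDeriv W h p) Set.univ (extChartAt 𝓘(ℝ, W) p p) := by
    have := hh.hasMFDerivAt.2
    -- The model has no boundary, so a derivative within its range is an ordinary one.
    rwa [modelWithCornersSelf_coe, Set.range_id] at this
  rwa [hasFDerivWithinAt_univ] at h'

theorem chartDeriv_congr {h h' : M → F₁} {p : M} (hh : h =ᶠ[𝓝 p] h') :
    chartDeriv W h p = chartDeriv W h' p := by
  have := hh.mfderiv_eq (I := 𝓘(ℝ, W)) (I' := 𝓘(ℝ, F₁))
  ext u
  exact congrArg (fun L : W →L[ℝ] F₁ => L u) this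

theorem chartDeriv_const (c : F₁) (p : M) : chartDeriv W (fun _ : M => c) p = 0 := by
  unfold chartDeriv
  rw [mvfderiv_const]
  rfl

theorem chartDeriv_eq_of_hasFDerivAt {h : M → F₁} {p : M} {h' : W →L[ℝ] F₁}
    (hh : MDifferentiableAt 𝓘(ℝ, W) 𝓘(ℝ, F₁) h p)
    (hh' : HasFDerivAt (h ∘ (extChartAt 𝓘(ℝ, W) p).symm) h' (extChartAt 𝓘(ℝ, W) p p)) :
    chartDeriv W h p = h' :=
  (hasFDerivAt_comp_extChartAt_symm hh).unique hh'

theorem chartDeriv_clm_comp (L : F₁ →L[ℝ] F₂) {h : M → F₁} {p : M}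
    (hh : MDifferentiableAt 𝓘(ℝ, W) 𝓘(ℝ, F₁) h p) :
    chartDeriv W (fun q => L (h q)) p = L ∘L chartDeriv W h p :=
  chartDeriv_eq_of_hasFDerivAt ((mdifferentiableAt_const (c := L)).clm_apply hh)
    (L.hasFDerivAt.comp _ (hasFDerivAt_comp_extChartAt_symm hh))

theorem chartDeriv_clm_apply {X : M → F₁ →L[ℝ] F₂} {Z : M → F₁} {p : M}
    (hX : MDifferentiableAt 𝓘(ℝ, W) 𝓘(ℝ, F₁ →L[ℝ] F₂) X p)
    (hZ : MDifferentiableAt 𝓘(ℝ, W) 𝓘(ℝ, F₁) Z p) (u : W) :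
    chartDeriv W (fun q => X q (Z q)) p u =
      chartDeriv W X p u (Z p) + X p (chartDeriv W Z p u) := by
  have h := (hasFDerivAt_comp_extChartAt_symm hX).clm_apply (hasFDerivAt_comp_extChartAt_symm hZ)
  rw [chartDeriv_eq_of_hasFDerivAt (hX.clm_apply hZ) h]
  simp [add_comm]

end Calculus

/-! ### Symmetry and metric compatibility of the Christoffel symbols. -/

section Christoffel

variable {V : Type*} [NormedAddCommGroup V] [NormedSpace ℝ V]
  {N : Type*} [TopologicalSpace N] [ChartedSpace V N] [IsManifold 𝓘(ℝ, V) ∞ N]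
  {G : ∀ x : N, TangentSpace 𝓘(ℝ, V) x →L[ℝ] TangentSpace 𝓘(ℝ, V) x →L[ℝ] ℝ} {x : N}

/-- Evaluation on constant vectors reduces the derivative to that of a scalar function, so the
symmetry of the metric passes to `metricDeriv`. -/
theorem metricDeriv_apply
    (hG : MDifferentiableAt 𝓘(ℝ, V) 𝓘(ℝ, V →L[ℝ] V →L[ℝ] ℝ) (metricInChart G x) x) (u v w : V) :
    metricDeriv G x u v w = chartDeriv V (fun y => metricInChart G x y v w) x u := by
  have h₁ := hG.clm_apply (mdifferentiableAt_const (c := v))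
  rw [chartDeriv_clm_apply (Z := fun _ : N => w) h₁ mdifferentiableAt_const,
    chartDeriv_clm_apply (Z := fun _ : N => v) hG mdifferentiableAt_const, chartDeriv_const,
    chartDeriv_const]
  simp
  rfl

theorem metricDeriv_symm
    (hG : MDifferentiableAt 𝓘(ℝ, V) 𝓘(ℝ, V →L[ℝ] V →L[ℝ] ℝ) (metricInChart G x) x)
    (hs : ∀ y u v, G y u v = G y v u) (u v w : V) :
    metricDeriv G x u v w = metricDeriv G x u w v := by
  rw [metricDeriv_apply hG, metricDeriv_apply hG]
  congr 2
  ext y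
  exact hs _ _ _

theorem christoffel_symm
    (hG : MDifferentiableAt 𝓘(ℝ, V) 𝓘(ℝ, V →L[ℝ] V →L[ℝ] ℝ) (metricInChart G x) x)
    (hs : ∀ y u v, G y u v = G y v u) (u v : V) :
    christoffel G x u v = christoffel G x v u := by
  have h : christoffelFirst G x u v = christoffelFirst G x v u := by
    ext w
    rw [christoffelFirst_apply, christoffelFirst_apply, metricDeriv_symm hG hs w u v]
    ring
  exact congrArg (metricInChart G x x).inverse h

theorem metricInChart_christoffel (hi : (metricInChart G x x).IsInvertible) (u v w : V) :
    metricInChart G x x (christoffel G x u v) w =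
      (metricDeriv G x u v w + metricDeriv G x v u w - metricDeriv G x w u v) / 2 :=
  (apply_inverse_apply hi _ _).trans (christoffelFirst_apply G x u v w)

/-- This is `∇g = 0` in coordinates: in the sum of the two Koszul expressions all terms but the
derivative along `u` cancel. -/
theorem metricInChart_christoffel_add
    (hG : MDifferentiableAt 𝓘(ℝ, V) 𝓘(ℝ, V →L[ℝ] V →L[ℝ] ℝ) (metricInChart G x) x)
    (hs : ∀ y u v, G y u v = G y v u) (hi : (metricInChart G x x).IsInvertible) (u v w : V) :
    metricInChart G x x (christoffel G x u v) w + metricInChart G x x v (christoffel G x u w)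
      = metricDeriv G x u v w := by
  have hs' : metricInChart G x x v (christoffel G x u w)
    = metricInChart G x x (christoffel G x u w) v := hs _ _ _
  rw [hs', metricInChart_christoffel hi, metricInChart_christoffel hi,
    metricDeriv_symm hG hs u w v, metricDeriv_symm hG hs w u v]
  ring

end Christoffel

/-! ### The Levi-Civita derivative along a map. -/

section CovDeriv

variable {V : Type*} [NormedAddCommGroup V] [NormedSpace ℝ V]
  {N : Type*} [TopologicalSpace N] [ChartedSpace V N] [IsManifold 𝓘(ℝ, V) ∞ N]
  (W : Type*) [NormedAddCommGroup W] [NormedSpace ℝ W]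
  {M : Type*} [TopologicalSpace M] [ChartedSpace W M] [IsManifold 𝓘(ℝ, W) ∞ M]
  (G : ∀ x : N, TangentSpace 𝓘(ℝ, V) x →L[ℝ] TangentSpace 𝓘(ℝ, V) x →L[ℝ] ℝ)
  (f : M → N) (p : M)

variable (V) in
/-- The derivative of `f` at `p`, read in the preferred charts at `p` and `f p`. -/
def pushforward : W →L[ℝ] V := mfderiv 𝓘(ℝ, W) 𝓘(ℝ, V) f p

/-- The value of a vector field along `f`, read in the preferred chart. -/
def fieldValue (A : ∀ q : M, TangentSpace 𝓘(ℝ, V) (f q)) : V := A p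

/-- The Levi-Civita derivative along `f`, read in the preferred charts. -/
def chartCovDeriv (A : ∀ q : M, TangentSpace 𝓘(ℝ, V) (f q)) : W →L[ℝ] V := covDerivAlong W G f A p

/-- The Hessian of `f`, read in the preferred charts. -/
def chartHessian : W →L[ℝ] W →L[ℝ] V := hessian W G f p

variable {f p}

omit [IsManifold 𝓘(ℝ, W) ∞ M] in
theorem chartCovDeriv_apply (A : ∀ q : M, TangentSpace 𝓘(ℝ, V) (f q)) (u : W) :
    chartCovDeriv W G f p A u = chartDeriv W (components f A p) p u
        + christoffel G (f p) (pushforward V W f p u) (components f A p p) := by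
  rw [components_self]
  rfl

theorem chartHessian_apply (u v : W) :
    chartHessian W G f p u v = chartDeriv W (derivComponents V W f p) p u v
        + christoffel G (f p) (pushforward V W f p u) (pushforward V W f p v) := rfl

/-- The Levi-Civita derivative of a tangential field is the Hessian of the immersion up to a
tangential term. -/
theorem chartCovDeriv_mfderiv (hf : ContMDiffAt 𝓘(ℝ, W) 𝓘(ℝ, V) ∞ f p)
    {Y : ∀ q : M, TangentSpace 𝓘(ℝ, W) q}
    (hY : MDifferentiableAt 𝓘(ℝ, W) 𝓘(ℝ, W) (components id Y p) p) (u : W) :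
    chartCovDeriv W G f p (fun q => mfderiv 𝓘(ℝ, W) 𝓘(ℝ, V) f q (Y q)) u =
      chartHessian W G f p u (components id Y p p)
        + pushforward V W f p (chartDeriv W (components id Y p) p u) := by
  have h : derivComponents V W f p p = pushforward V W f p := derivComponents_self f p
  rw [chartCovDeriv_apply, chartHessian_apply, chartDeriv_congr (components_mfderiv f p Y),
    chartDeriv_clm_apply (mdifferentiableAt_derivComponents hf) hY,
    (components_mfderiv f p Y).eq_of_nhds, h]
  abel

-- Metric compatibility along `f`: the product rule produces a derivative of the metric components
-- along `df u`, and `metricInChart_christoffel_add` splits it into the Christoffel terms of the two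
-- covariant derivatives.
omit [IsManifold 𝓘(ℝ, W) ∞ M] in
theorem chartDeriv_inner
    (g : ContMDiffRiemannianMetric 𝓘(ℝ, V) ∞ V (TangentSpace 𝓘(ℝ, V) : N → Type _))
    [FiniteDimensional ℝ V]
    (hf : MDifferentiableAt 𝓘(ℝ, W) 𝓘(ℝ, V) f p) {A B : ∀ q : M, TangentSpace 𝓘(ℝ, V) (f q)}
    (hA : MDifferentiableAt 𝓘(ℝ, W) 𝓘(ℝ, V) (components f A p) p)
    (hB : MDifferentiableAt 𝓘(ℝ, W) 𝓘(ℝ, V) (components f B p) p) (u : W) :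
    chartDeriv W (fun q => g.inner (f q) (A q) (B q)) p u =
      metricInChart g.inner (f p) (f p) (chartCovDeriv W g.inner f p A u) (components f B p p)
        + metricInChart g.inner (f p) (f p) (components f A p p)
          (chartCovDeriv W g.inner f p B u) := by
  have hG := mdifferentiableAt_metricInChart g (f p)
  have hGf : MDifferentiableAt 𝓘(ℝ, W) 𝓘(ℝ, V →L[ℝ] V →L[ℝ] ℝ)
      (fun q => metricInChart g.inner (f p) (f q)) p := hG.comp p hf
  have hGd : chartDeriv W (fun q => metricInChart g.inner (f p) (f q)) p u
      = metricDeriv g.inner (f p) (pushforward V W f p u) :=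
    congrArg (fun L : W →L[ℝ] V →L[ℝ] V →L[ℝ] ℝ => L u) (mfderiv_comp p hG hf)
  have hi : (metricInChart g.inner (f p) (f p)).IsInvertible := by
    rw [metricInChart_self]
    exact isInvertible_of_posDef _ (g.pos (f p))
  rw [← chartDeriv_congr (metricInChart_components g.inner hf.continuousAt A B),
    chartDeriv_clm_apply (hGf.clm_apply hA) hB, chartDeriv_clm_apply hGf hA, hGd, add_apply,
    ← metricInChart_christoffel_add hG g.symm hi, chartCovDeriv_apply, chartCovDeriv_apply]
  simp only [map_add, add_apply]
  ring

end CovDeriv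

/-! ### Symmetry of the Hessian and the Lie bracket in a chart. -/

section Torsion

variable {V : Type*} [NormedAddCommGroup V] [NormedSpace ℝ V]
  {N : Type*} [TopologicalSpace N] [ChartedSpace V N] [IsManifold 𝓘(ℝ, V) ∞ N]
  {W : Type*} [NormedAddCommGroup W] [NormedSpace ℝ W]
  {M : Type*} [TopologicalSpace M] [ChartedSpace W M] [IsManifold 𝓘(ℝ, W) ∞ M]
  (G : ∀ x : N, TangentSpace 𝓘(ℝ, V) x →L[ℝ] TangentSpace 𝓘(ℝ, V) x →L[ℝ] ℝ)
  {f : M → N} {p : M}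

omit [IsManifold 𝓘(ℝ, W) ∞ M] in
theorem eventually_extChartAt_target (p : M) :
    ∀ᶠ z in 𝓝 (extChartAt 𝓘(ℝ, W) p p), z ∈ (extChartAt 𝓘(ℝ, W) p).target :=
  extChartAt_target_mem_nhds p

/-- The equality holds on a neighbourhood, not just at the centre, so the derivative of
`derivComponents` is a genuine second derivative of the chart expression of `f`, and its symmetry is
Schwarz's theorem. -/
theorem derivComponents_comp_symm (hf : ContMDiff 𝓘(ℝ, W) 𝓘(ℝ, V) ∞ f) (p : M) :
    derivComponents V W f p ∘ (extChartAt 𝓘(ℝ, W) p).symm =ᶠ[𝓝 (extChartAt 𝓘(ℝ, W) p p)]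
      fderiv ℝ (writtenInExtChartAt 𝓘(ℝ, W) 𝓘(ℝ, V) p f) := by
  have hcont : ContinuousAt (f ∘ (extChartAt 𝓘(ℝ, W) p).symm) (extChartAt 𝓘(ℝ, W) p p) :=
    hf.continuous.continuousAt.comp (continuousAt_extChartAt_symm p)
  have hev : ∀ᶠ z in 𝓝 (extChartAt 𝓘(ℝ, W) p p),
      f ((extChartAt 𝓘(ℝ, W) p).symm z) ∈ (chartAt V (f p)).source := by
    refine hcont.eventually ?_
    simp only [Function.comp_apply, extChartAt_to_inv]
    exact chart_source_mem_nhds V (f p)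
  filter_upwards [eventually_extChartAt_target (W := W) p, hev] with z hz hfz
  have hq : (extChartAt 𝓘(ℝ, W) p).symm z ∈ (chartAt W p).source := by
    rw [← extChartAt_source 𝓘(ℝ, W)]
    exact (extChartAt 𝓘(ℝ, W) p).map_target hz
  have h₁ := inTangentCoordinates_eq_mfderiv_comp (I := 𝓘(ℝ, W)) (I' := 𝓘(ℝ, V)) (f := id) (g := f)
    (ϕ := fun q => mfderiv 𝓘(ℝ, W) 𝓘(ℝ, V) f q) (x₀ := p) (x := (extChartAt 𝓘(ℝ, W) p).symm z) hq hfz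
  refine h₁.trans ?_
  simp only [id]
  rw [(extChartAt 𝓘(ℝ, W) p).right_inv hz, modelWithCornersSelf_coe, Set.range_id,
    mfderivWithin_univ, ← mfderiv_eq_fderiv]
  have hs : MDifferentiableAt 𝓘(ℝ, W) 𝓘(ℝ, W) (extChartAt 𝓘(ℝ, W) p).symm z := by
    have := mdifferentiableWithinAt_extChartAt_symm (I := 𝓘(ℝ, W)) hz
    rwa [modelWithCornersSelf_coe, Set.range_id, mdifferentiableWithinAt_univ] at this
  have hfd : MDifferentiableAt 𝓘(ℝ, W) 𝓘(ℝ, V) f ((extChartAt 𝓘(ℝ, W) p).symm z) :=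
    hf.mdifferentiable (by simp) _
  have he : MDifferentiableAt 𝓘(ℝ, V) 𝓘(ℝ, V) (extChartAt 𝓘(ℝ, V) (f p))
    (f ((extChartAt 𝓘(ℝ, W) p).symm z)) := mdifferentiableAt_extChartAt hfz
  exact ((mfderiv_comp z he (hfd.comp z hs)).trans
    (congrArg _ (mfderiv_comp z hfd hs))).symm

theorem chartDeriv_derivComponents_symm (hf : ContMDiff 𝓘(ℝ, W) 𝓘(ℝ, V) ∞ f) (u v : W) :
    chartDeriv W (derivComponents V W f p) p u v = chartDeriv W (derivComponents V W f p) p v u := by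
  have hd := hasFDerivAt_comp_extChartAt_symm (mdifferentiableAt_derivComponents (hf p))
  have hd' := hd.congr_of_eventuallyEq (derivComponents_comp_symm hf p).symm
  have hc : ContDiffAt ℝ ∞ (writtenInExtChartAt 𝓘(ℝ, W) 𝓘(ℝ, V) p f) (extChartAt 𝓘(ℝ, W) p p) := by
    have := (contMDiffAt_iff.1 (hf p)).2
    rwa [modelWithCornersSelf_coe, Set.range_id, contDiffWithinAt_univ] at this
  have hsymm := hc.isSymmSndFDerivAt (by
    rw [minSmoothness_of_isRCLikeNormedField]
    exact ENat.LEInfty.out)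
  have := hsymm u v
  rwa [hd'.fderiv] at this

theorem chartHessian_symm
    (g : ContMDiffRiemannianMetric 𝓘(ℝ, V) ∞ V (TangentSpace 𝓘(ℝ, V) : N → Type _))
    (hf : ContMDiff 𝓘(ℝ, W) 𝓘(ℝ, V) ∞ f) (u v : W) :
    chartHessian W g.inner f p u v = chartHessian W g.inner f p v u := by
  rw [chartHessian_apply, chartHessian_apply, chartDeriv_derivComponents_symm hf,
    christoffel_symm (mdifferentiableAt_metricInChart g _) g.symm]

/-- The manifold bracket is defined by pulling back along the inverse chart. The inverse of that
chart's derivative is the derivative of the chart, which is the tangent trivialization used by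
`components`. -/
theorem mpullbackWithin_extChartAt_symm (X : ∀ q : M, TangentSpace 𝓘(ℝ, W) q) (p : M) :
    (mpullbackWithin 𝓘(ℝ, W) 𝓘(ℝ, W) (extChartAt 𝓘(ℝ, W) p).symm X (Set.range 𝓘(ℝ, W)) : W → W)
      =ᶠ[𝓝 (extChartAt 𝓘(ℝ, W) p p)] components id X p ∘ (extChartAt 𝓘(ℝ, W) p).symm := by
  filter_upwards [eventually_extChartAt_target (W := W) p] with z hz
  have hq : (extChartAt 𝓘(ℝ, W) p).symm z ∈ (chartAt W p).source := by
    rw [← extChartAt_source 𝓘(ℝ, W)]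
    exact (extChartAt 𝓘(ℝ, W) p).map_target hz
  have h₁ : (mfderivWithin 𝓘(ℝ, W) 𝓘(ℝ, W) (extChartAt 𝓘(ℝ, W) p).symm (Set.range 𝓘(ℝ, W)) z).inverse
      = mfderiv 𝓘(ℝ, W) 𝓘(ℝ, W) (extChartAt 𝓘(ℝ, W) p) ((extChartAt 𝓘(ℝ, W) p).symm z) :=
    ContinuousLinearMap.inverse_eq
      (mfderivWithin_extChartAt_symm_comp_mfderiv_extChartAt hz)
      (mfderiv_extChartAt_comp_mfderivWithin_extChartAt_symm hz)
  rw [mpullbackWithin_apply, h₁, ← TangentBundle.continuousLinearMapAt_trivializationAt hq]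
  rfl

theorem mlieBracket_eq_chartDeriv {X Y : ∀ q : M, TangentSpace 𝓘(ℝ, W) q}
    (hX : MDifferentiableAt 𝓘(ℝ, W) 𝓘(ℝ, W) (components id X p) p)
    (hY : MDifferentiableAt 𝓘(ℝ, W) 𝓘(ℝ, W) (components id Y p) p) :
    fieldValue id p (mlieBracket 𝓘(ℝ, W) X Y) =
      chartDeriv W (components id Y p) p (components id X p p)
        - chartDeriv W (components id X p) p (components id Y p p) := by
  let X' : W → W :=
    mpullbackWithin 𝓘(ℝ, W) 𝓘(ℝ, W) (extChartAt 𝓘(ℝ, W) p).symm X (Set.range 𝓘(ℝ, W))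
  let Y' : W → W :=
    mpullbackWithin 𝓘(ℝ, W) 𝓘(ℝ, W) (extChartAt 𝓘(ℝ, W) p).symm Y (Set.range 𝓘(ℝ, W))
  have hX' : HasFDerivAt X' (chartDeriv W (components id X p) p) (extChartAt 𝓘(ℝ, W) p p) :=
    (hasFDerivAt_comp_extChartAt_symm hX).congr_of_eventuallyEq
      (mpullbackWithin_extChartAt_symm X p)
  have hY' : HasFDerivAt Y' (chartDeriv W (components id Y p) p) (extChartAt 𝓘(ℝ, W) p p) :=
    (hasFDerivAt_comp_extChartAt_symm hY).congr_of_eventuallyEq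
      (mpullbackWithin_extChartAt_symm Y p)
  -- The definition of the bracket ends with a pullback by the chart; at its own centre the chart
  -- has identity derivative, so this pullback disappears.
  have hid : ∀ w : W, (mfderiv 𝓘(ℝ, W) 𝓘(ℝ, W) (extChartAt 𝓘(ℝ, W) p) p : W →L[ℝ] W).inverse w = w := by
    intro w
    have h : (mfderiv 𝓘(ℝ, W) 𝓘(ℝ, W) (extChartAt 𝓘(ℝ, W) p) p : W →L[ℝ] W)
        = ContinuousLinearMap.id ℝ W := mfderiv_extChartAt_self
    refine (congrArg (fun L : W →L[ℝ] W => L.inverse w) h).trans ?_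
    simp only [ContinuousLinearMap.inverse_id, ContinuousLinearMap.id_apply]
  have hset : (extChartAt 𝓘(ℝ, W) p).symm ⁻¹' Set.univ ∩ Set.range 𝓘(ℝ, W) = Set.univ := by
    simp
  have h₁ : fieldValue id p (mlieBracket 𝓘(ℝ, W) X Y) = lieBracketWithin ℝ X' Y'
      ((extChartAt 𝓘(ℝ, W) p).symm ⁻¹' Set.univ ∩ Set.range 𝓘(ℝ, W)) (extChartAt 𝓘(ℝ, W) p p) :=
    hid _
  have hXp : X' (extChartAt 𝓘(ℝ, W) p p) = components id X p p :=
    (mpullbackWithin_extChartAt_symm X p).eq_of_nhds.trans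
      (congrArg (components id X p) (extChartAt_to_inv p))
  have hYp : Y' (extChartAt 𝓘(ℝ, W) p p) = components id Y p p :=
    (mpullbackWithin_extChartAt_symm Y p).eq_of_nhds.trans
      (congrArg (components id Y p) (extChartAt_to_inv p))
  rw [h₁, hset, lieBracketWithin_univ, lieBracket, hX'.fderiv, hY'.fderiv, hXp, hYp]

end Torsion

/-! ### Differentiability of a tangent field from that of its image under `df`. -/

section TangentialLift

/-- With `L` a left inverse of `T a`, the operator `L ∘ T z` is invertible for `z` near `a`, and `Y
z = (L ∘ T z)⁻¹ (L (B z))` is differentiable because inversion is. -/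
theorem differentiableAt_of_clm_apply {W V X : Type*} [NormedAddCommGroup W] [NormedSpace ℝ W]
    [FiniteDimensional ℝ W] [NormedAddCommGroup V] [NormedSpace ℝ V] [FiniteDimensional ℝ V]
    [NormedAddCommGroup X] [NormedSpace ℝ X]
    {T : X → W →L[ℝ] V} {Y : X → W} {B : X → V} {a : X}
    (hT : DifferentiableAt ℝ T a) (hB : DifferentiableAt ℝ B a) (hi : Function.Injective (T a))
    (h : ∀ᶠ z in 𝓝 a, T z (Y z) = B z) : DifferentiableAt ℝ Y a := by
  obtain ⟨L, hL⟩ := (T a : W →ₗ[ℝ] V).exists_leftInverse_of_injective (LinearMap.ker_eq_bot.2 hi)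
  let S : X → W →L[ℝ] W := fun z => (LinearMap.toContinuousLinearMap L) ∘L T z
  have hS : DifferentiableAt ℝ S a := (differentiableAt_const _).clm_comp hT
  have hSa : S a = ContinuousLinearEquiv.refl ℝ W := by
    ext w
    exact LinearMap.congr_fun hL w
  have hinv : DifferentiableAt ℝ (fun z => (S z).inverse) a := by
    have h₁ : ContDiffAt ℝ 1 ContinuousLinearMap.inverse (S a) := by
      rw [hSa]
      exact contDiffAt_map_inverse _
    exact (h₁.differentiableAt one_ne_zero).comp a hS
  have hev : ∀ᶠ z in 𝓝 a, (S z).IsInvertible := by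
    have := ContinuousLinearEquiv.nhds (ContinuousLinearEquiv.refl ℝ W)
    rw [← hSa] at this
    exact hS.continuousAt.eventually this
  refine (hinv.clm_apply ((differentiableAt_const
    (LinearMap.toContinuousLinearMap L)).clm_apply hB)).congr_of_eventuallyEq ?_
  filter_upwards [h, hev] with z hz hSz
  exact (hSz.inverse_apply_eq.2 (by rw [← hz]; rfl)).symm

variable {V : Type*} [NormedAddCommGroup V] [NormedSpace ℝ V]
  {N : Type*} [TopologicalSpace N] [ChartedSpace V N] [IsManifold 𝓘(ℝ, V) ∞ N]
  {W : Type*} [NormedAddCommGroup W] [NormedSpace ℝ W]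
  {M : Type*} [TopologicalSpace M] [ChartedSpace W M] [IsManifold 𝓘(ℝ, W) ∞ M]
  {f : M → N} {p : M}

theorem mdifferentiableAt_components_of_mfderiv [FiniteDimensional ℝ W] [FiniteDimensional ℝ V]
    (hf : ContMDiffAt 𝓘(ℝ, W) 𝓘(ℝ, V) ∞ f p) (hi : Function.Injective (pushforward V W f p))
    {Y : ∀ q : M, TangentSpace 𝓘(ℝ, W) q}
    (hY : MDifferentiableAt 𝓘(ℝ, W) 𝓘(ℝ, V)
      (components f (fun q => mfderiv 𝓘(ℝ, W) 𝓘(ℝ, V) f q (Y q)) p) p) :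
    MDifferentiableAt 𝓘(ℝ, W) 𝓘(ℝ, W) (components id Y p) p := by
  have h₁ := (hasFDerivAt_comp_extChartAt_symm (mdifferentiableAt_derivComponents hf)).differentiableAt
  have h₂ := (hasFDerivAt_comp_extChartAt_symm hY).differentiableAt
  have h₃ : DifferentiableAt ℝ (components id Y p ∘ (extChartAt 𝓘(ℝ, W) p).symm)
      (extChartAt 𝓘(ℝ, W) p p) := by
    refine differentiableAt_of_clm_apply h₁ h₂ ?_ ?_
    · simp only [Function.comp_apply, extChartAt_to_inv]
      rw [derivComponents_self]
      exact hi
    · have hc := continuousAt_extChartAt_symm (I := 𝓘(ℝ, W)) p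
      rw [ContinuousAt, extChartAt_to_inv] at hc
      filter_upwards [hc.eventually (components_mfderiv (V := V) f p Y)] with z hz
      exact hz.symm
  have h₄ := MDifferentiableAt.comp p h₃.mdifferentiableAt (mdifferentiableAt_extChartAt (I := 𝓘(ℝ, W)) (mem_chart_source W p))
  refine h₄.congr_of_eventuallyEq ?_
  filter_upwards [extChartAt_source_mem_nhds (I := 𝓘(ℝ, W)) p] with q hq
  exact (congrArg (components id Y p) ((extChartAt 𝓘(ℝ, W) p).left_inv hq)).symm

end TangentialLift

/-! ### The complex structure in charts and its parallelism. -/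

section ComplexStructure

variable {E : Type*} [NormedAddCommGroup E] [NormedSpace ℂ E]
  {N : Type*} [TopologicalSpace N] [ChartedSpace E N] [IsManifold 𝓘(ℝ, E) ∞ N]

theorem continuousLinearMapAt_smul_I [IsManifold 𝓘(ℂ, E) ∞ N] {x y : N}
    (hy : y ∈ (trivializationAt E (TangentSpace 𝓘(ℝ, E) : N → Type _) x).baseSet) (v : E) :
    (trivializationAt E (TangentSpace 𝓘(ℝ, E) : N → Type _) x).continuousLinearMapAt ℝ y
        (Complex.I • v : E)
      = Complex.I • ((trivializationAt E (TangentSpace 𝓘(ℝ, E) : N → Type _) x).continuousLinearMapAt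
          ℝ y v : E) := by
  have hy' : y ∈ (chartAt E x).source := hy
  rw [TangentBundle.continuousLinearMapAt_trivializationAt_eq_core hy',
    tangentBundleCore_coordChange_achart]
  -- The transition map is holomorphic, so its real derivative is complex linear.
  have hd : DifferentiableAt ℂ (extChartAt 𝓘(ℝ, E) x ∘ (extChartAt 𝓘(ℝ, E) y).symm)
      (extChartAt 𝓘(ℝ, E) y y) := by
    have h := (contDiffWithinAt_ext_coord_change (I := 𝓘(ℂ, E)) (n := ∞) x y
      (y := extChartAt 𝓘(ℂ, E) y y) (by
        simpa [PartialEquiv.trans_source] using hy')).differentiableWithinAt (by simp)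
    rwa [modelWithCornersSelf_coe, Set.range_id, differentiableWithinAt_univ] at h
  rw [modelWithCornersSelf_coe, Set.range_id, fderivWithin_univ, hd.fderiv_restrictScalars ℝ]
  exact map_smul (fderiv ℂ _ _) Complex.I v

variable (E) in
/-- Multiplication by the imaginary unit as a real linear map. -/
def mulI : E →L[ℝ] E := Complex.I • ContinuousLinearMap.id ℝ E

theorem mulI_mulI (v : E) : mulI E (mulI E v) = -v := by
  change Complex.I • Complex.I • v = -v
  rw [smul_smul, Complex.I_mul_I, neg_one_smul]

theorem components_J [IsManifold 𝓘(ℂ, E) ∞ N] {M : Type*} [TopologicalSpace M] {f : M → N} {p : M}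
    (hf : ContinuousAt f p) (A : ∀ q : M, TangentSpace 𝓘(ℝ, E) (f q)) :
    components f (fun q => J (f q) (A q)) p =ᶠ[𝓝 p] fun q => mulI E (components f A p q) := by
  filter_upwards [hf.eventually (eventually_mem_baseSet (V := E) (f p))] with q hq
  exact continuousLinearMapAt_smul_I hq (A q)

/-- The field whose components in the preferred chart at `x` are constant. -/
def constField (x : N) (v : E) (y : N) : TangentSpace 𝓘(ℝ, E) y :=
  (trivializationAt E (TangentSpace 𝓘(ℝ, E) : N → Type _) x).symmL ℝ y v

theorem components_constField (x : N) (v : E) :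
    components id (constField x v) x =ᶠ[𝓝 x] fun _ => v := by
  filter_upwards [eventually_mem_baseSet (V := E) x] with y hy
  exact Trivialization.continuousLinearMapAt_symmL _ hy v

theorem contMDiffAt_constField (x : N) (v : E) :
    ContMDiffAt 𝓘(ℝ, E) 𝓘(ℝ, E).tangent ∞
      (fun y => (⟨y, constField x v y⟩ : TangentBundle 𝓘(ℝ, E) N)) x := by
  refine (contMDiffAt_section (IB := 𝓘(ℝ, E)) (F := E)
    (E := (TangentSpace 𝓘(ℝ, E) : N → Type _)) (s := constField x v) x).2 ?_
  refine (contMDiffAt_const (c := v)).congr_of_eventuallyEq ?_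
  filter_upwards [eventually_mem_baseSet (V := E) x, components_constField x v] with y hy h
  exact (Trivialization.continuousLinearMapAt_apply_of_mem ℝ _ hy _).symm.trans h

/-- Testing `∇J = 0` on a field with constant components removes every derivative term and leaves
the Christoffel symbols. -/
theorem christoffel_mulI [IsManifold 𝓘(ℂ, E) ∞ N]
    {G : ∀ x : N, TangentSpace 𝓘(ℝ, E) x →L[ℝ] TangentSpace 𝓘(ℝ, E) x →L[ℝ] ℝ} {U : Set N}
    (hG : IsParallelJOn G U) {x : N} (hx : x ∈ U) (u v : E) :
    christoffel G x u (mulI E v) = mulI E (christoffel G x u v) := by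
  have hid : pushforward E E id x = ContinuousLinearMap.id ℝ E := mfderiv_id (I := 𝓘(ℝ, E)) (x := x)
  have h : chartCovDeriv E G id x (fun y => J y (constField x v y)) u
      = mulI E (chartCovDeriv E G id x (constField x v) u) :=
    hG x hx (constField x v) (contMDiffAt_constField x v) u
  have hc := components_constField x v
  have hJ : components id (fun y => J y (constField x v y)) x =ᶠ[𝓝 x] fun _ => mulI E v := by
    filter_upwards [components_J continuousAt_id (constField x v), hc] with y h₁ h₂
    exact h₁.trans (congrArg _ h₂)
  rw [chartCovDeriv_apply, chartCovDeriv_apply, chartDeriv_congr hc, chartDeriv_congr hJ,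
    hc.eq_of_nhds, hJ.eq_of_nhds, chartDeriv_const, chartDeriv_const, hid] at h
  simpa using h

end ComplexStructure

/-! ### Conformal change of the Christoffel symbols. -/

section Conformal

variable {V : Type*} [NormedAddCommGroup V] [NormedSpace ℝ V]
  {N : Type*} [TopologicalSpace N] [ChartedSpace V N] [IsManifold 𝓘(ℝ, V) ∞ N]

/-- The Christoffel symbols of the conformal metric `exp (-φ) g`. -/
theorem metricInChart_christoffel_exp_smul [FiniteDimensional ℝ V]
    (g : ContMDiffRiemannianMetric 𝓘(ℝ, V) ∞ V (TangentSpace 𝓘(ℝ, V) : N → Type _)) {φ : N → ℝ}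
    {x : N} (hφ : MDifferentiableAt 𝓘(ℝ, V) 𝓘(ℝ, ℝ) φ x) (u v w : V) :
    metricInChart g.inner x x (christoffel (fun y => Real.exp (-φ y) • g.inner y) x u v) w =
      metricInChart g.inner x x (christoffel g.inner x u v) w
        - (chartDeriv V φ x u * metricInChart g.inner x x v w
          + chartDeriv V φ x v * metricInChart g.inner x x u w
          - chartDeriv V φ x w * metricInChart g.inner x x u v) / 2 := by
  set G : ∀ x : N, TangentSpace 𝓘(ℝ, V) x →L[ℝ] TangentSpace 𝓘(ℝ, V) x →L[ℝ] ℝ :=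
    fun y => Real.exp (-φ y) • g.inner y with hG
  have hg := mdifferentiableAt_metricInChart g x
  have hc : ∀ y, metricInChart G x y = Real.exp (-φ y) • metricInChart g.inner x y := by
    intro y
    ext a b
    rfl
  have hpos : ∀ v : V, v ≠ 0 → 0 < metricInChart g.inner x x v v := by
    rw [metricInChart_self]
    exact g.pos x
  have hi : (metricInChart g.inner x x).IsInvertible := isInvertible_of_posDef _ hpos
  have hI : (metricInChart G x x).IsInvertible := by
    refine isInvertible_of_posDef _ fun v hv => ?_
    rw [hc]
    exact mul_pos (Real.exp_pos _) (hpos v hv)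
  have hexp : HasFDerivAt ((fun y => Real.exp (-φ y)) ∘ (extChartAt 𝓘(ℝ, V) x).symm)
      (Real.exp (-φ x) • -chartDeriv V φ x) (extChartAt 𝓘(ℝ, V) x x) := by
    have := (hasFDerivAt_comp_extChartAt_symm hφ).neg.exp
    simpa [Function.comp_def] using this
  have hexpd : MDifferentiableAt 𝓘(ℝ, V) 𝓘(ℝ, ℝ) (fun y => Real.exp (-φ y)) x :=
    (Real.differentiable_exp.mdifferentiable _).comp x hφ.neg
  have hGd : MDifferentiableAt 𝓘(ℝ, V) 𝓘(ℝ, V →L[ℝ] V →L[ℝ] ℝ) (metricInChart G x) x := by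
    have := hexpd.smul hg
    exact this.congr_of_eventuallyEq (Filter.Eventually.of_forall hc)
  have hder : ∀ a b c : V, metricDeriv G x a b c = Real.exp (-φ x) *
      (metricDeriv g.inner x a b c - chartDeriv V φ x a * metricInChart g.inner x x b c) := by
    intro a b c
    have h₁ : chartDeriv V (metricInChart G x) x = _ := chartDeriv_eq_of_hasFDerivAt hGd
      ((hexp.smul (hasFDerivAt_comp_extChartAt_symm hg)).congr_of_eventuallyEq
        (Filter.Eventually.of_forall fun z => hc _))
    have h₂ : metricDeriv G x a b c = chartDeriv V (metricInChart G x) x a b c := rfl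
    have h₃ : metricDeriv g.inner x a b c = chartDeriv V (metricInChart g.inner x) x a b c := rfl
    rw [h₂, h₁, h₃]
    simp
    ring
  have h₁ := metricInChart_christoffel hI u v w
  rw [hder, hder, hder, hc] at h₁
  have h₂ : Real.exp (-φ x) * metricInChart g.inner x x (christoffel G x u v) w = _ := h₁
  rw [metricInChart_christoffel hi]
  refine mul_left_cancel₀ (Real.exp_pos (-φ x)).ne' (h₂.trans ?_)
  ring

end Conformal

/-! ### The covariant derivative of `J` in terms of the Lee form. -/

section LCKIdentity

variable {E : Type*} [NormedAddCommGroup E] [NormedSpace ℂ E] [FiniteDimensional ℂ E]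
  {N : Type*} [TopologicalSpace N] [ChartedSpace E N] [IsManifold 𝓘(ℂ, E) ∞ N]
  [IsManifold 𝓘(ℝ, E) ∞ N]
  {g : ContMDiffRiemannianMetric 𝓘(ℝ, E) ∞ E (TangentSpace 𝓘(ℝ, E) : N → Type _)}
  {α : ∀ x : N, TangentSpace 𝓘(ℝ, E) x →L[ℝ] ℝ}

/-- A 1-form at a point, read in the preferred chart. -/
def chartForm (α : ∀ x : N, TangentSpace 𝓘(ℝ, E) x →L[ℝ] ℝ) (x : N) : E →L[ℝ] ℝ := α x

omit [FiniteDimensional ℂ E] [IsManifold 𝓘(ℂ, E) ∞ N] in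
theorem metricInChart_mulI (hg : IsLCKWithLeeForm g α) (x : N) (u v : E) :
    metricInChart g.inner x x (mulI E u) v = -metricInChart g.inner x x u (mulI E v) := by
  have h : metricInChart g.inner x x (mulI E (mulI E u)) (mulI E v)
      = metricInChart g.inner x x (mulI E u) v := by
    rw [metricInChart_self]
    exact hg.hermitian x _ _
  rw [← h, mulI_mulI, map_neg, neg_apply]

/-- The conformal change formula is applied at (u, Jv, w) and at (u, v, Jw). The Kähler symbols
satisfy Γ(u, Jv) = JΓ(u, v) and `J` is skew for `g`, so their contributions cancel in the sum; only
the symbols of `g` and the terms in dφ = 2α remain. -/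
theorem christoffel_mulI_of_lck (hg : IsLCKWithLeeForm g α) (x : N) (u v w : E) :
    metricInChart g.inner x x (christoffel g.inner x u (mulI E v)) w
      + metricInChart g.inner x x (christoffel g.inner x u v) (mulI E w)
      = chartForm α x (mulI E v) * metricInChart g.inner x x u w
        - chartForm α x w * metricInChart g.inner x x u (mulI E v)
        + chartForm α x v * metricInChart g.inner x x u (mulI E w)
        - chartForm α x (mulI E w) * metricInChart g.inner x x u v := by
  obtain ⟨U, φ, hU, hx, hφ, hpar, hα⟩ := hg.locally_conformal x
  have hφ' : MDifferentiableAt 𝓘(ℝ, E) 𝓘(ℝ, ℝ) φ x :=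
    (hφ.contMDiffAt (hU.mem_nhds hx)).mdifferentiableAt (by simp)
  have hα' : ∀ v, chartForm α x v = chartDeriv E φ x v / 2 := by
    intro v
    have := congrArg (fun L : E →L[ℝ] ℝ => L v) (hα x hx)
    refine this.trans ?_
    change (1 / 2 : ℝ) * chartDeriv E φ x v = _
    ring
  have h₁ := metricInChart_christoffel_exp_smul g hφ' u (mulI E v) w
  have h₂ := metricInChart_christoffel_exp_smul g hφ' u v (mulI E w)
  rw [christoffel_mulI hpar hx, metricInChart_mulI hg] at h₁
  have h₃ := metricInChart_mulI hg x v w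
  simp only [hα']
  rw [h₃] at h₁
  linear_combination (-1) * h₁ - h₂

variable {W : Type*} [NormedAddCommGroup W] [NormedSpace ℝ W]
  {M : Type*} [TopologicalSpace M] [ChartedSpace W M]
  {f : M → N} {p : M}

/-- The covariant derivative of `J` on a locally conformally Kähler manifold. -/
theorem chartCovDeriv_J (hg : IsLCKWithLeeForm g α) (hf : ContinuousAt f p)
    {A : ∀ q : M, TangentSpace 𝓘(ℝ, E) (f q)}
    (hA : MDifferentiableAt 𝓘(ℝ, W) 𝓘(ℝ, E) (components f A p) p) (u : W) (w : E) :
    metricInChart g.inner (f p) (f p)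
        (chartCovDeriv W g.inner f p (fun q => J (f q) (A q)) u) w
      + metricInChart g.inner (f p) (f p) (chartCovDeriv W g.inner f p A u) (mulI E w)
      = chartForm α (f p) (mulI E (components f A p p))
          * metricInChart g.inner (f p) (f p) (pushforward E W f p u) w
        - chartForm α (f p) w
          * metricInChart g.inner (f p) (f p) (pushforward E W f p u) (mulI E (components f A p p))
        + chartForm α (f p) (components f A p p)
          * metricInChart g.inner (f p) (f p) (pushforward E W f p u) (mulI E w)
        - chartForm α (f p) (mulI E w)
          * metricInChart g.inner (f p) (f p) (pushforward E W f p u) (components f A p p) := by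
  have hJ := components_J hf A
  rw [chartCovDeriv_apply, chartCovDeriv_apply, chartDeriv_congr hJ, hJ.eq_of_nhds,
    chartDeriv_clm_comp _ hA, ← christoffel_mulI_of_lck hg]
  simp only [map_add, add_apply, ContinuousLinearMap.comp_apply, metricInChart_mulI hg (f p)]
  ring

end LCKIdentity

/-! ### Injectivity of the differential, and sections with a prescribed value. -/

theorem injective_mfderiv_of_isImmersion {V : Type*} [NormedAddCommGroup V] [NormedSpace ℝ V]
    {N : Type*} [TopologicalSpace N] [ChartedSpace V N] [IsManifold 𝓘(ℝ, V) ∞ N]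
    {W : Type*} [NormedAddCommGroup W] [NormedSpace ℝ W]
    {M : Type*} [TopologicalSpace M] [ChartedSpace W M] [IsManifold 𝓘(ℝ, W) ∞ M]
    {f : M → N} (hf : Manifold.IsImmersion 𝓘(ℝ, W) 𝓘(ℝ, V) ∞ f) (p : M) :
    Function.Injective (pushforward V W f p) := by
  have h := hf.isImmersionAt p
  -- In adapted charts `f` is x ↦ (x, 0). Projecting to the first factor gives a differentiable
  -- local left inverse of `f`, whose derivative is a left inverse of `df`.
  let L : V →L[ℝ] W := ContinuousLinearMap.fst ℝ W h.complement ∘L (h.equiv.symm : V →L[ℝ] _)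
  have hL : ∀ q ∈ h.domChart.source, L (h.codChart (f q)) = h.domChart q := by
    intro q hq
    have hq' : h.domChart q ∈ (h.domChart.extend 𝓘(ℝ, W)).target := by
      simpa using h.domChart.map_source hq
    have h₁ := h.writtenInCharts hq'
    have h₂ : h.codChart (f q) = h.equiv (h.domChart q, 0) := by
      simpa [h.domChart.left_inv hq] using h₁
    simp [L, h₂]
  have hpL : L (h.codChart (f p)) = h.domChart p := hL p h.mem_domChart_source
  have hev : h.domChart.symm ∘ L ∘ h.codChart ∘ f =ᶠ[𝓝 p] id := by
    filter_upwards [h.domChart.open_source.mem_nhds h.mem_domChart_source] with q hq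
    simp only [Function.comp_apply, hL q hq, h.domChart.left_inv hq, id]
  have hc : MDifferentiableAt 𝓘(ℝ, V) 𝓘(ℝ, V) h.codChart (f p) :=
    (contMDiffAt_of_mem_maximalAtlas h.codChart_mem_maximalAtlas
      h.mem_codChart_source).mdifferentiableAt (by simp)
  have hd : MDifferentiableAt 𝓘(ℝ, W) 𝓘(ℝ, W) h.domChart.symm (L (h.codChart (f p))) := by
    rw [hpL]
    exact (contMDiffAt_symm_of_mem_maximalAtlas h.domChart_mem_maximalAtlas
      (h.domChart.map_source h.mem_domChart_source)).mdifferentiableAt (by simp)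
  have hLc : MDifferentiableAt 𝓘(ℝ, V) 𝓘(ℝ, W) (L ∘ h.codChart) (f p) :=
    MDifferentiableAt.comp (f p) L.differentiableAt.mdifferentiableAt hc
  have hR : MDifferentiableAt 𝓘(ℝ, V) 𝓘(ℝ, W) (h.domChart.symm ∘ L ∘ h.codChart) (f p) :=
    MDifferentiableAt.comp (f p) hd hLc
  have hfd : MDifferentiableAt 𝓘(ℝ, W) 𝓘(ℝ, V) f p := hf.contMDiff.mdifferentiable (by simp) p
  have hcomp := mfderiv_comp p hR hfd
  rw [show (h.domChart.symm ∘ L ∘ h.codChart) ∘ f = h.domChart.symm ∘ L ∘ h.codChart ∘ f from rfl,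
    hev.mfderiv_eq, mfderiv_id] at hcomp
  intro u v huv
  have hu := congrArg (fun T : W →L[ℝ] W => T u) hcomp
  have hv := congrArg (fun T : W →L[ℝ] W => T v) hcomp
  exact hu.trans ((congrArg (mfderiv 𝓘(ℝ, V) 𝓘(ℝ, W) (h.domChart.symm ∘ L ∘ h.codChart) (f p) :
    V →L[ℝ] W) huv).trans hv.symm)

/-- Conditions on global sections must be tested on every single vector of `D p`. A combination of
the local frame with constant coefficients, cut off by a bump function equal to 1 at `p`, realizes
any such vector. -/
theorem exists_isSection_eq {W : Type*} [NormedAddCommGroup W] [NormedSpace ℝ W]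
    [FiniteDimensional ℝ W] {M : Type*} [TopologicalSpace M] [T2Space M] [ChartedSpace W M]
    [IsManifold 𝓘(ℝ, W) ∞ M] {D : ∀ p : M, Submodule ℝ (TangentSpace 𝓘(ℝ, W) p)}
    (hD : IsSmoothDistribution D) {p : M} {v : TangentSpace 𝓘(ℝ, W) p} (hv : v ∈ D p) :
    ∃ X, IsSection D X ∧ X p = v := by
  obtain ⟨k, X, U, hU, hp, hX, hspan⟩ := hD p
  rw [← (hspan p hp).2, Submodule.mem_span_range_iff_exists_fun] at hv
  obtain ⟨c, hc⟩ := hv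
  obtain ⟨ρ, -, hρ⟩ := (SmoothBumpFunction.nhds_basis_tsupport (I := 𝓘(ℝ, W)) p).mem_iff.1
    (hU.mem_nhds hp)
  have hs : ContMDiffOn 𝓘(ℝ, W) 𝓘(ℝ, W).tangent ∞
      (fun q => (⟨q, ∑ i, c i • X i q⟩ : TangentBundle 𝓘(ℝ, W) M)) U :=
    ContMDiffOn.sum_section fun i _ => (hX i).const_smul_section
  refine ⟨fun q => ρ q • ∑ i, c i • X i q,
    ⟨ContMDiffOn.smul_section_of_tsupport ρ.contMDiff.contMDiffOn hU hρ hs, fun q => ?_⟩, ?_⟩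
  · by_cases hq : q ∈ U
    · refine (D q).smul_mem _ ((D q).sum_mem fun i _ => (D q).smul_mem _ ?_)
      rw [← (hspan q hq).2]
      exact Submodule.subset_span ⟨i, rfl⟩
    · have : ρ q = 0 := image_eq_zero_of_notMem_tsupport fun h => hq (hρ h)
      simp only [this, zero_smul]
      exact (D q).zero_mem
  · simp only [ρ.eq_one, one_smul]
    exact hc

/-! ### Tangential and normal parts, second fundamental form, shape operator. -/

section Extrinsic

variable (W : Type*) [NormedAddCommGroup W] [NormedSpace ℝ W]
  {V : Type*} [NormedAddCommGroup V] [NormedSpace ℝ V]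
  {N : Type*} [TopologicalSpace N] [ChartedSpace V N] [IsManifold 𝓘(ℝ, V) ∞ N]
  (g : ContMDiffRiemannianMetric 𝓘(ℝ, V) ∞ V (TangentSpace 𝓘(ℝ, V) : N → Type _))
  {M : Type*} [TopologicalSpace M] [ChartedSpace W M]
  (f : M → N) (p : M)

/-- The metric of the ambient manifold at `f p`, read in the preferred chart. -/
def ambientForm : V →L[ℝ] V →L[ℝ] ℝ := metricInChart g.inner (f p) (f p)

/-- The induced metric, read in the preferred chart. -/
def inducedForm : W →L[ℝ] W →L[ℝ] ℝ := inducedMetric W g f p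

/-- The tangential projection, read in the preferred charts. -/
def chartTangential : V →L[ℝ] W := tangentialPart W g f p

/-- The normal projection, read in the preferred chart. -/
def chartNormal : V →L[ℝ] V := normalPart W g f p

/-- The second fundamental form, read in the preferred charts. -/
def chartSecondForm [IsManifold 𝓘(ℝ, W) ∞ M] : W →L[ℝ] W →L[ℝ] V := secondFundamentalForm W g f p

/-- The shape operator, read in the preferred charts. -/
def chartShape [IsManifold 𝓘(ℝ, W) ∞ M] (ξ : V) : W →L[ℝ] W := shapeOperator W g f p ξ

omit [TopologicalSpace M] in
theorem ambientForm_symm (u v : V) : ambientForm g f p u v = ambientForm g f p v u := by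
  unfold ambientForm
  rw [metricInChart_self]
  exact g.symm _ _ _

omit [TopologicalSpace M] in
theorem ambientForm_pos (v : V) (hv : v ≠ 0) : 0 < ambientForm g f p v v := by
  unfold ambientForm
  rw [metricInChart_self]
  exact g.pos _ _ hv

theorem inducedForm_apply (u v : W) : inducedForm W g f p u v
    = ambientForm g f p (pushforward V W f p u) (pushforward V W f p v) := by
  unfold ambientForm
  rw [metricInChart_self]
  rfl

variable {f p}

theorem isInvertible_inducedForm [FiniteDimensional ℝ W]
    (hi : Function.Injective (pushforward V W f p)) : (inducedForm W g f p).IsInvertible := by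
  refine isInvertible_of_posDef _ fun v hv => ?_
  rw [inducedForm_apply]
  exact ambientForm_pos _ _ _ _ fun h => hv (hi (h.trans (map_zero _).symm))

theorem inducedForm_chartTangential [FiniteDimensional ℝ W]
    (hi : Function.Injective (pushforward V W f p)) (ξ : V) (v : W) :
    inducedForm W g f p (chartTangential W g f p ξ) v
      = ambientForm g f p ξ (pushforward V W f p v) := by
  refine (apply_inverse_apply (isInvertible_inducedForm W g hi) _ v).trans ?_
  unfold ambientForm
  rw [metricInChart_self]
  rfl

theorem chartNormal_apply (ξ : V) : chartNormal W g f p ξ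
    = ξ - pushforward V W f p (chartTangential W g f p ξ) := rfl

theorem ambientForm_chartNormal_pushforward [FiniteDimensional ℝ W]
    (hi : Function.Injective (pushforward V W f p)) (ξ : V) (v : W) :
    ambientForm g f p (chartNormal W g f p ξ) (pushforward V W f p v) = 0 := by
  rw [chartNormal_apply, map_sub, sub_apply, ← inducedForm_apply,
    inducedForm_chartTangential W g hi, sub_self]

theorem ambientForm_chartNormal_left
    {w : V} (hw : ∀ v, ambientForm g f p (pushforward V W f p v) w = 0) (ξ : V) :
    ambientForm g f p (chartNormal W g f p ξ) w = ambientForm g f p ξ w := by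
  rw [chartNormal_apply, map_sub, sub_apply, hw, sub_zero]

/-- An equation between normal vectors need only be paired with normal vectors, which is where the
tangential terms of the Gauss formula drop out. -/
theorem chartNormal_ext [FiniteDimensional ℝ W]
    (hi : Function.Injective (pushforward V W f p)) {ξ η : V}
    (hξ : ∀ v, ambientForm g f p ξ (pushforward V W f p v) = 0)
    (hη : ∀ v, ambientForm g f p η (pushforward V W f p v) = 0)
    (h : ∀ w, (∀ v, ambientForm g f p (pushforward V W f p v) w = 0) →
      ambientForm g f p ξ w = ambientForm g f p η w) : ξ = η := by
  refine eq_of_posDef (ambientForm_pos g f p) fun w => ?_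
  have hw : w = chartNormal W g f p w + pushforward V W f p (chartTangential W g f p w) := by
    rw [chartNormal_apply, sub_add_cancel]
  rw [hw, map_add, map_add, hξ, hη, h]
  intro v
  rw [ambientForm_symm]
  exact ambientForm_chartNormal_pushforward W g hi w v

variable [IsManifold 𝓘(ℝ, W) ∞ M]

theorem ambientForm_chartSecondForm
    {w : V} (hw : ∀ v, ambientForm g f p (pushforward V W f p v) w = 0) (u v : W) :
    ambientForm g f p (chartSecondForm W g f p u v) w
      = ambientForm g f p (chartHessian W g.inner f p u v) w :=
  ambientForm_chartNormal_left W g hw _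

theorem chartSecondForm_symm (hf : ContMDiff 𝓘(ℝ, W) 𝓘(ℝ, V) ∞ f) (u v : W) :
    chartSecondForm W g f p u v = chartSecondForm W g f p v u :=
  congrArg (chartNormal W g f p) (chartHessian_symm g hf u v)

theorem inducedForm_chartShape [FiniteDimensional ℝ W]
    (hi : Function.Injective (pushforward V W f p)) (ξ : V) (u v : W) :
    inducedForm W g f p (chartShape W g f p ξ u) v
      = ambientForm g f p (chartSecondForm W g f p u v) ξ := by
  refine (apply_inverse_apply (isInvertible_inducedForm W g hi) _ v).trans ?_
  rw [ambientForm_symm]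
  unfold ambientForm
  rw [metricInChart_self]
  rfl

/-- The Levi-Civita connection has no torsion. -/
theorem chartCovDeriv_sub_chartCovDeriv (hf : ContMDiff 𝓘(ℝ, W) 𝓘(ℝ, V) ∞ f)
    {X Y : ∀ q : M, TangentSpace 𝓘(ℝ, W) q}
    (hX : MDifferentiableAt 𝓘(ℝ, W) 𝓘(ℝ, W) (components id X p) p)
    (hY : MDifferentiableAt 𝓘(ℝ, W) 𝓘(ℝ, W) (components id Y p) p) :
    chartCovDeriv W g.inner f p (fun q => mfderiv 𝓘(ℝ, W) 𝓘(ℝ, V) f q (Y q)) (fieldValue id p X)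
      - chartCovDeriv W g.inner f p (fun q => mfderiv 𝓘(ℝ, W) 𝓘(ℝ, V) f q (X q)) (fieldValue id p Y)
      = pushforward V W f p (fieldValue id p (mlieBracket 𝓘(ℝ, W) X Y)) := by
  have h₁ := chartCovDeriv_mfderiv W g.inner (hf p) hY (fieldValue id p X)
  have h₂ := chartCovDeriv_mfderiv W g.inner (hf p) hX (fieldValue id p Y)
  have e₁ : components id X p p = fieldValue id p X := components_self id X p
  have e₂ : components id Y p p = fieldValue id p Y := components_self id Y p
  refine (congrArg₂ (· - ·) h₁ h₂).trans ?_
  rw [mlieBracket_eq_chartDeriv hX hY, e₁, e₂, map_sub]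
  have h₃ : chartHessian W g.inner f p (fieldValue id p X) (fieldValue id p Y) = chartHessian W g.inner f p (fieldValue id p Y) (fieldValue id p X) :=
    chartHessian_symm g hf _ _
  have e : ∀ a b c d : V, a = c → (a + b) - (c + d) = b - d := by
    rintro a b c d rfl
    abel
  exact e _ _ _ _ h₃

end Extrinsic

/-! ### Linear algebra of the two distributions, and the holomorphic bracket. -/

section SemiSlant

variable {E : Type*} [NormedAddCommGroup E] [NormedSpace ℂ E]
  {N : Type*} [TopologicalSpace N] [ChartedSpace E N]
  [IsManifold 𝓘(ℝ, E) ∞ N]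
  {g : ContMDiffRiemannianMetric 𝓘(ℝ, E) ∞ E (TangentSpace 𝓘(ℝ, E) : N → Type _)}
  {α : ∀ x : N, TangentSpace 𝓘(ℝ, E) x →L[ℝ] ℝ}
  {W : Type*} [NormedAddCommGroup W] [NormedSpace ℝ W]
  {M : Type*} [TopologicalSpace M] [ChartedSpace W M]
  {f : M → N} {p : M}

variable (W) in
/-- The tangential part of `J` on tangent vectors, read in the preferred charts. -/
def chartP (g : ContMDiffRiemannianMetric 𝓘(ℝ, E) ∞ E (TangentSpace 𝓘(ℝ, E) : N → Type _))
    (f : M → N) (p : M) : W →L[ℝ] W := P g f p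

variable (W) in
/-- The normal part of `J` on tangent vectors, read in the preferred charts. -/
def chartF (g : ContMDiffRiemannianMetric 𝓘(ℝ, E) ∞ E (TangentSpace 𝓘(ℝ, E) : N → Type _))
    (f : M → N) (p : M) : W →L[ℝ] E := F g f p

theorem mulI_pushforward (u : W) : mulI E (pushforward E W f p u)
    = pushforward E W f p (chartP W g f p u) + chartF W g f p u :=
  (add_sub_cancel (pushforward E W f p (chartP W g f p u)) (mulI E (pushforward E W f p u))).symm

omit [TopologicalSpace M] in
theorem ambientForm_mulI (hg : IsLCKWithLeeForm g α) (u v : E) :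
    ambientForm g f p (mulI E u) v = -ambientForm g f p u (mulI E v) :=
  metricInChart_mulI hg _ u v

/-- A distribution at a point, read in the preferred chart. -/
def chartDistribution (D : ∀ p : M, Submodule ℝ (TangentSpace 𝓘(ℝ, W) p)) (p : M) :
    Submodule ℝ W := D p

variable [FiniteDimensional ℝ W]

theorem ambientForm_chartF (hi : Function.Injective (pushforward E W f p)) (u v : W) :
    ambientForm g f p (chartF W g f p u) (pushforward E W f p v) = 0 :=
  ambientForm_chartNormal_pushforward W g hi _ v

theorem ambientForm_mulI_pushforward (hi : Function.Injective (pushforward E W f p)) (u v : W) :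
    ambientForm g f p (mulI E (pushforward E W f p u)) (pushforward E W f p v)
      = ambientForm g f p (pushforward E W f p (chartP W g f p u)) (pushforward E W f p v) := by
  rw [mulI_pushforward (g := g), map_add, add_apply, ambientForm_chartF hi, add_zero]

theorem chartP_eq_of_mulI (hi : Function.Injective (pushforward E W f p)) {u v : W}
    (h : pushforward E W f p v = mulI E (pushforward E W f p u)) : chartP W g f p u = v := by
  refine eq_of_posDef (B := inducedForm W g f p) (fun w hw => ?_) fun w => ?_
  · rw [inducedForm_apply]
    exact ambientForm_pos _ _ _ _ fun h => hw (hi (h.trans (map_zero _).symm))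
  · rw [inducedForm_apply, inducedForm_apply, ← ambientForm_mulI_pushforward hi, h]

variable [IsManifold 𝓘(ℝ, W) ∞ M] {D Dθ : ∀ p : M, Submodule ℝ (TangentSpace 𝓘(ℝ, W) p)} {θ : M → ℝ}

omit [FiniteDimensional ℝ W] in
theorem IsPointwiseSemiSlant.mem_sup (hM : IsPointwiseSemiSlant g f D Dθ θ) (u : W) :
    u ∈ chartDistribution D p ⊔ chartDistribution Dθ p := by
  have h : chartDistribution D p ⊔ chartDistribution Dθ p = ⊤ := hM.span p
  rw [h]
  exact Submodule.mem_top

omit [FiniteDimensional ℝ W] in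
theorem IsSection.mem_chartDistribution {X : ∀ q : M, TangentSpace 𝓘(ℝ, W) q} (hX : IsSection D X)
    (p : M) : fieldValue id p X ∈ chartDistribution D p := hX.2 p

theorem IsPointwiseSemiSlant.pushforward_chartP (hM : IsPointwiseSemiSlant g f D Dθ θ)
    (hi : Function.Injective (pushforward E W f p)) {u : W} (hu : u ∈ chartDistribution D p) :
    pushforward E W f p (chartP W g f p u) = mulI E (pushforward E W f p u) ∧
      chartP W g f p u ∈ chartDistribution D p := by
  have h : mulI E (pushforward E W f p u) ∈ pushforward E W f p '' (chartDistribution D p : Set W) := by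
    have := hM.holomorphic p
    exact this.subset ⟨u, hu, rfl⟩
  obtain ⟨v, hv, hvu⟩ := h
  rw [chartP_eq_of_mulI hi hvu]
  exact ⟨hvu, hv⟩

theorem IsPointwiseSemiSlant.chartF_eq_zero (hM : IsPointwiseSemiSlant g f D Dθ θ)
    (hi : Function.Injective (pushforward E W f p)) {u : W} (hu : u ∈ chartDistribution D p) :
    chartF W g f p u = 0 := by
  have h := mulI_pushforward (g := g) (f := f) (p := p) u
  rw [(hM.pushforward_chartP hi hu).1] at h
  exact left_eq_add.1 h

omit [FiniteDimensional ℝ W] in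
theorem IsPointwiseSemiSlant.ambientForm_eq_zero (hM : IsPointwiseSemiSlant g f D Dθ θ)
    {u v : W} (hu : u ∈ chartDistribution D p) (hv : v ∈ chartDistribution Dθ p) :
    ambientForm g f p (pushforward E W f p u) (pushforward E W f p v) = 0 := by
  rw [← inducedForm_apply]
  exact hM.orthogonal p u hu v hv

omit [FiniteDimensional ℝ W] in
theorem IsPointwiseSemiSlant.chartP_chartP (hM : IsPointwiseSemiSlant g f D Dθ θ)
    {z : W} (hz : z ∈ chartDistribution Dθ p) :
    chartP W g f p (chartP W g f p z) = -(Real.cos (θ p) ^ 2) • z :=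
  hM.slant p z hz

/-- On the slant distribution `F` is injective. -/
theorem IsPointwiseSemiSlant.eq_zero_of_chartF_eq_zero (hM : IsPointwiseSemiSlant g f D Dθ θ)
    (hθ : Dθ p ≠ ⊥ → Real.cos (θ p) ^ 2 < 1)
    (hi : Function.Injective (pushforward E W f p)) {z : W} (hz : z ∈ chartDistribution Dθ p)
    (h : chartF W g f p z = 0) : z = 0 := by
  by_contra hne
  have hcos : Real.cos (θ p) ^ 2 < 1 := hθ fun hbot => hne ((Submodule.eq_bot_iff _).1 hbot z hz)
  have h₁ := mulI_pushforward (g := g) (f := f) (p := p) z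
  rw [h, add_zero] at h₁
  -- If Fz = 0 then Jz = Pz, so P²z = J²z = -z; the slant condition makes this -cos²θ z, forcing z =
  -- 0.
  have h₂ : pushforward E W f p (-z) = mulI E (pushforward E W f p (chartP W g f p z)) := by
    rw [← h₁, mulI_mulI, map_neg]
  have h₃ := chartP_eq_of_mulI (g := g) hi h₂
  rw [hM.chartP_chartP hz] at h₃
  have h₄ : (1 - Real.cos (θ p) ^ 2) • z = 0 := by
    rw [sub_smul, one_smul, sub_eq_add_neg, ← neg_smul, h₃, add_neg_cancel]
  exact (smul_ne_zero (sub_pos.2 hcos).ne' hne) h₄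

/-- `F` kills `D` and is injective on the complement `Dθ`, so integrability of `D` becomes the
vanishing of `F` on brackets. -/
theorem IsPointwiseSemiSlant.mem_iff_chartF_eq_zero (hM : IsPointwiseSemiSlant g f D Dθ θ)
    (hθ : Dθ p ≠ ⊥ → Real.cos (θ p) ^ 2 < 1)
    (hi : Function.Injective (pushforward E W f p)) (u : W) :
    u ∈ chartDistribution D p ↔ chartF W g f p u = 0 := by
  refine ⟨hM.chartF_eq_zero hi, fun h => ?_⟩
  obtain ⟨d, hd, z, hz, hdz⟩ := Submodule.mem_sup.1 (hM.mem_sup u)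
  have hz0 : z = 0 := by
    refine hM.eq_zero_of_chartF_eq_zero hθ hi hz ?_
    rw [← hdz, map_add, hM.chartF_eq_zero hi hd, zero_add] at h
    exact h
  rw [← hdz, hz0, add_zero]
  exact hd

omit [FiniteDimensional ℝ W] in
theorem IsPointwiseSemiSlant.mem_slant_iff (hM : IsPointwiseSemiSlant g f D Dθ θ)
    (hi : Function.Injective (pushforward E W f p)) (u : W) :
    u ∈ chartDistribution Dθ p ↔ ∀ x : W, x ∈ chartDistribution D p →
      ambientForm g f p (pushforward E W f p x) (pushforward E W f p u) = 0 := by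
  refine ⟨fun hu x hx => hM.ambientForm_eq_zero hx hu, fun h => ?_⟩
  obtain ⟨d, hd, z, hz, hdz⟩ := Submodule.mem_sup.1 (hM.mem_sup u)
  have hd0 : d = 0 := by
    by_contra hne
    have h₁ := h d hd
    rw [← hdz, map_add, map_add, hM.ambientForm_eq_zero hd hz, add_zero] at h₁
    exact (ambientForm_pos g f p (pushforward E W f p d)
      fun h => hne (hi (h.trans (map_zero _).symm))).ne' h₁
  rw [← hdz, hd0, zero_add]
  exact hz

theorem IsPointwiseSemiSlant.J_mfderiv (hM : IsPointwiseSemiSlant g f D Dθ θ)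
    (hi : ∀ p, Function.Injective (pushforward E W f p)) {X : ∀ q : M, TangentSpace 𝓘(ℝ, W) q}
    (hX : ∀ q, X q ∈ D q) :
    (fun q => J (f q) (mfderiv 𝓘(ℝ, W) 𝓘(ℝ, E) f q (X q)))
      = fun q => mfderiv 𝓘(ℝ, W) 𝓘(ℝ, E) f q (P g f q (X q)) :=
  funext fun q => (hM.pushforward_chartP (hi q) (hX q)).1.symm

variable [FiniteDimensional ℂ E] [IsManifold 𝓘(ℂ, E) ∞ N]

/-- On `D` one has df(PX) = J df X, whose components are differentiable; injectivity of `df`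
transfers this to `PX`. -/
theorem IsPointwiseSemiSlant.mdifferentiableAt_components_P
    (hM : IsPointwiseSemiSlant g f D Dθ θ) (hf : ContMDiff 𝓘(ℝ, W) 𝓘(ℝ, E) ∞ f)
    (hi : ∀ p, Function.Injective (pushforward E W f p)) {X : ∀ q : M, TangentSpace 𝓘(ℝ, W) q}
    (hX : IsSection D X) :
    MDifferentiableAt 𝓘(ℝ, W) 𝓘(ℝ, W) (components id (fun q => P g f q (X q)) p) p := by
  refine mdifferentiableAt_components_of_mfderiv (hf p) (hi p) ?_
  rw [← hM.J_mfderiv hi hX.2]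
  exact ((mdifferentiableAt_const (c := mulI E)).clm_apply
    (mdifferentiableAt_components_mfderiv (hf p)
      (mdifferentiableAt_components_id (hX.1 p)))).congr_of_eventuallyEq
    (components_J (hf p).continuousAt _)

/-- The covariant derivative of `J X` for a section `X` of the holomorphic distribution. -/
theorem IsPointwiseSemiSlant.chartCovDeriv_P
    (hM : IsPointwiseSemiSlant g f D Dθ θ) (hg : IsLCKWithLeeForm g α)
    (hf : ContMDiff 𝓘(ℝ, W) 𝓘(ℝ, E) ∞ f)
    (hi : ∀ p, Function.Injective (pushforward E W f p)) {X : ∀ q : M, TangentSpace 𝓘(ℝ, W) q}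
    (hX : IsSection D X) (u : W) (w : E) :
    ambientForm g f p (chartCovDeriv W g.inner f p
        (fun q => mfderiv 𝓘(ℝ, W) 𝓘(ℝ, E) f q (P g f q (X q))) u) w
      + ambientForm g f p (chartCovDeriv W g.inner f p
        (fun q => mfderiv 𝓘(ℝ, W) 𝓘(ℝ, E) f q (X q)) u) (mulI E w)
      = chartForm α (f p) (mulI E (pushforward E W f p (fieldValue id p X)))
          * ambientForm g f p (pushforward E W f p u) w
        - chartForm α (f p) w * ambientForm g f p (pushforward E W f p u)
          (mulI E (pushforward E W f p (fieldValue id p X)))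
        + chartForm α (f p) (pushforward E W f p (fieldValue id p X))
          * ambientForm g f p (pushforward E W f p u) (mulI E w)
        - chartForm α (f p) (mulI E w)
          * ambientForm g f p (pushforward E W f p u) (pushforward E W f p (fieldValue id p X)) := by
  have h := chartCovDeriv_J hg (hf p).continuousAt (mdifferentiableAt_components_mfderiv (hf p)
    (mdifferentiableAt_components_id (hX.1 p))) u w
  have hc : components f (fun q => mfderiv 𝓘(ℝ, W) 𝓘(ℝ, E) f q (X q)) p p
    = pushforward E W f p (fieldValue id p X) := components_self _ _ _
  rw [hM.J_mfderiv hi hX.2, hc] at h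
  exact h

-- Paired with a normal vector, ∇_u Y and the Hessian agree, since they differ by a tangential term.
-- This trades `h` for covariant derivatives.
omit [FiniteDimensional ℝ W] [FiniteDimensional ℂ E] [IsManifold 𝓘(ℂ, E) ∞ N] in
theorem ambientForm_chartSecondForm_eq_chartCovDeriv (hf : ContMDiff 𝓘(ℝ, W) 𝓘(ℝ, E) ∞ f)
    {Y : ∀ q : M, TangentSpace 𝓘(ℝ, W) q}
    (hY : MDifferentiableAt 𝓘(ℝ, W) 𝓘(ℝ, W) (components id Y p) p) {w : E}
    (hw : ∀ v, ambientForm g f p (pushforward E W f p v) w = 0) (u : W) :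
    ambientForm g f p (chartSecondForm W g f p u (fieldValue id p Y)) w
      = ambientForm g f p (chartCovDeriv W g.inner f p
        (fun q => mfderiv 𝓘(ℝ, W) 𝓘(ℝ, E) f q (Y q)) u) w := by
  have hc : components id Y p p = fieldValue id p Y := components_self _ _ _
  rw [ambientForm_chartSecondForm W g hw, chartCovDeriv_mfderiv W g.inner (hf p) hY, map_add,
    add_apply, hw, add_zero, hc]

/-- The Lee vector field at a point, read in the preferred chart. -/
def chartSharp (g : ContMDiffRiemannianMetric 𝓘(ℝ, E) ∞ E (TangentSpace 𝓘(ℝ, E) : N → Type _))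
    (α : ∀ x : N, TangentSpace 𝓘(ℝ, E) x →L[ℝ] ℝ) (x : N) : E := sharp g α x

omit [TopologicalSpace M] [IsManifold 𝓘(ℂ, E) ∞ N] in
theorem chartForm_eq_sharp
    (g : ContMDiffRiemannianMetric 𝓘(ℝ, E) ∞ E (TangentSpace 𝓘(ℝ, E) : N → Type _))
    (α : ∀ x : N, TangentSpace 𝓘(ℝ, E) x →L[ℝ] ℝ) (f : M → N) (p : M) (w : E) :
    chartForm α (f p) w = ambientForm g f p (chartSharp g α (f p)) w := by
  have hs : chartSharp g α (f p) = (ambientForm g f p).inverse (chartForm α (f p)) := by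
    unfold ambientForm
    rw [metricInChart_self]
    rfl
  rw [hs, apply_inverse_apply (isInvertible_of_posDef _ (ambientForm_pos g f p))]

/-- The normal component of `J [X, Y]` for sections `X`, `Y` of the holomorphic distribution. -/
theorem IsPointwiseSemiSlant.chartF_mlieBracket
    (hM : IsPointwiseSemiSlant g f D Dθ θ) (hg : IsLCKWithLeeForm g α)
    (hf : ContMDiff 𝓘(ℝ, W) 𝓘(ℝ, E) ∞ f)
    (hi : ∀ p, Function.Injective (pushforward E W f p)) {X Y : ∀ q : M, TangentSpace 𝓘(ℝ, W) q}
    (hX : IsSection D X) (hY : IsSection D Y) (p : M) :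
    chartF W g f p (fieldValue id p (mlieBracket 𝓘(ℝ, W) X Y))
      = chartSecondForm W g f p (chartP W g f p (fieldValue id p Y)) (fieldValue id p X)
        - chartSecondForm W g f p (chartP W g f p (fieldValue id p X)) (fieldValue id p Y)
        - (2 * inducedForm W g f p (chartP W g f p (fieldValue id p X)) (fieldValue id p Y)) •
          chartNormal W g f p (chartSharp g α (f p)) := by
  refine chartNormal_ext W g (hi p) (ambientForm_chartF (hi p) _) (fun v => ?_) fun w hw => ?_
  · rw [map_sub, map_sub, map_smul, sub_apply, sub_apply, smul_apply,
      ambientForm_chartNormal_pushforward W g (hi p)]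
    have h : ∀ a b : W, ambientForm g f p (chartSecondForm W g f p a b)
        (pushforward E W f p v) = 0 := fun a b =>
      ambientForm_chartNormal_pushforward W g (hi p) _ v
    rw [h, h]
    simp
  · have hXd := mdifferentiableAt_components_id (hX.1 p)
    have hYd := mdifferentiableAt_components_id (hY.1 p)
    have hX' := hM.pushforward_chartP (hi p) (hX.mem_chartDistribution p)
    have hY' := hM.pushforward_chartP (hi p) (hY.mem_chartDistribution p)
    have e₁ := hM.chartCovDeriv_P hg hf hi hY (fieldValue id p X) w (p := p)
    have e₂ := hM.chartCovDeriv_P hg hf hi hX (fieldValue id p Y) w (p := p)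
    have s₁ := ambientForm_chartSecondForm_eq_chartCovDeriv hf
      (hM.mdifferentiableAt_components_P hf hi hY) hw (fieldValue id p X)
    have s₂ := ambientForm_chartSecondForm_eq_chartCovDeriv hf
      (hM.mdifferentiableAt_components_P hf hi hX) hw (fieldValue id p Y)
    have t := chartCovDeriv_sub_chartCovDeriv W g hf hXd hYd
    have t' := congrArg (fun v => ambientForm g f p v (mulI E w)) t
    -- Jw stays orthogonal to `D` because `D` is invariant under the skew map `J`.
    have hwI : ∀ u : W, u ∈ chartDistribution D p →
        ambientForm g f p (pushforward E W f p u) (mulI E w) = 0 := fun u hu => by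
      have := ambientForm_mulI hg (f := f) (p := p) (pushforward E W f p u) w
      rw [← (hM.pushforward_chartP (hi p) hu).1, hw] at this
      linarith
    have hbr : ambientForm g f p (chartF W g f p (fieldValue id p (mlieBracket 𝓘(ℝ, W) X Y))) w
        = -ambientForm g f p (pushforward E W f p (fieldValue id p (mlieBracket 𝓘(ℝ, W) X Y)))
          (mulI E w) := by
      rw [← ambientForm_mulI hg, mulI_pushforward (g := g), map_add, add_apply, hw, zero_add]
    have hXI := hwI (fieldValue id p X) (hX.2 p)
    have hYI := hwI (fieldValue id p Y) (hY.2 p)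
    have hXw := hw (fieldValue id p X)
    have hYw := hw (fieldValue id p Y)
    have hα := chartForm_eq_sharp g α f p w
    have hs₁ := chartSecondForm_symm W g hf (chartP W g f p (fieldValue id p Y)) (fieldValue id p X) (p := p)
    have hs₂ := chartSecondForm_symm W g hf (chartP W g f p (fieldValue id p X)) (fieldValue id p Y) (p := p)
    rw [hbr, map_sub, map_sub, map_smul, sub_apply, sub_apply, smul_apply,
      ambientForm_chartNormal_left W g hw, inducedForm_apply, hs₁, hs₂, hX'.1, ← hα, smul_eq_mul]
    have r₁ := ambientForm_mulI hg (f := f) (p := p) (pushforward E W f p (fieldValue id p X))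
      (pushforward E W f p (fieldValue id p Y))
    have r₂ := ambientForm_symm g f p (mulI E (pushforward E W f p (fieldValue id p X)))
      (pushforward E W f p (fieldValue id p Y))
    have r₃ := ambientForm_symm g f p (pushforward E W f p (fieldValue id p X)) (pushforward E W f p (fieldValue id p Y))
    simp only [map_sub, sub_apply] at t'
    change ambientForm g f p (chartSecondForm W g f p (fieldValue id p X) (chartP W g f p (fieldValue id p Y))) w = _ at s₁
    change ambientForm g f p (chartSecondForm W g f p (fieldValue id p Y) (chartP W g f p (fieldValue id p X))) w = _ at s₂
    rw [s₁, s₂]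
    rw [hXI, hXw, r₃] at e₁
    rw [hYI, hYw] at e₂
    -- The α(Jw)g(X,Y) terms cancel by symmetry; g(X,JY) - g(Y,JX) = -2g(JX,Y) accounts for the
    -- factor 2.
    linear_combination t' - e₁ + e₂ + chartForm α (f p) w * (r₂ + r₁)

end SemiSlant

/-! ### The shape operator identity and the slant bracket. -/

section Slant

variable {E : Type*} [NormedAddCommGroup E] [NormedSpace ℂ E] [FiniteDimensional ℂ E]
  {N : Type*} [TopologicalSpace N] [ChartedSpace E N]
  [IsManifold 𝓘(ℂ, E) ∞ N] [IsManifold 𝓘(ℝ, E) ∞ N]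
  {g : ContMDiffRiemannianMetric 𝓘(ℝ, E) ∞ E (TangentSpace 𝓘(ℝ, E) : N → Type _)}
  {α : ∀ x : N, TangentSpace 𝓘(ℝ, E) x →L[ℝ] ℝ}
  {W : Type*} [NormedAddCommGroup W] [NormedSpace ℝ W] [FiniteDimensional ℝ W]
  {M : Type*} [TopologicalSpace M] [ChartedSpace W M] [IsManifold 𝓘(ℝ, W) ∞ M]
  {f : M → N} {D Dθ : ∀ p : M, Submodule ℝ (TangentSpace 𝓘(ℝ, W) p)} {θ : M → ℝ}

/-- The two shape operator terms are g(∇_z(JX), Fy) and g(∇_z X, FPy). The formula for `∇J` with w =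
Jy and with w = Py, together with JPy = -cos²θ y + FPy, expresses their difference. The terms with
g(z,X) and g(z,JX) vanish by orthogonality of `D` and `Dθ`. -/
theorem IsPointwiseSemiSlant.inducedForm_chartShape_sub
    (hM : IsPointwiseSemiSlant g f D Dθ θ) (hg : IsLCKWithLeeForm g α)
    (hf : ContMDiff 𝓘(ℝ, W) 𝓘(ℝ, E) ∞ f)
    (hi : ∀ p, Function.Injective (pushforward E W f p)) {X : ∀ q : M, TangentSpace 𝓘(ℝ, W) q}
    (hX : IsSection D X) {p : M} {y z : W} (hy : y ∈ chartDistribution Dθ p)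
    (hz : z ∈ chartDistribution Dθ p) :
    inducedForm W g f p
        (chartShape W g f p (chartF W g f p y) (chartP W g f p (fieldValue id p X))
          - chartShape W g f p (chartF W g f p (chartP W g f p y)) (fieldValue id p X)) z
      = (1 - Real.cos (θ p) ^ 2) *
        (ambientForm g f p (chartCovDeriv W g.inner f p
            (fun q => mfderiv 𝓘(ℝ, W) 𝓘(ℝ, E) f q (X q)) z) (pushforward E W f p y)
          - chartForm α (f p) (pushforward E W f p (fieldValue id p X))
            * ambientForm g f p (pushforward E W f p z) (pushforward E W f p y)) := by
  have hn : ∀ u v : W, ambientForm g f p (pushforward E W f p v) (chartF W g f p u) = 0 :=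
    fun u v => by rw [ambientForm_symm, ambientForm_chartF (hi p)]
  have hXd := mdifferentiableAt_components_id (hX.1 p)
  have hx := hX.mem_chartDistribution p
  have hx' := hM.pushforward_chartP (hi p) hx
  have s₁ : ambientForm g f p
      (chartSecondForm W g f p z (chartP W g f p (fieldValue id p X))) (chartF W g f p y) = _ :=
    ambientForm_chartSecondForm_eq_chartCovDeriv hf (hM.mdifferentiableAt_components_P hf hi hX)
      (hn y) z
  have s₂ := ambientForm_chartSecondForm_eq_chartCovDeriv hf hXd (hn (chartP W g f p y)) z
  have e₁ := hM.chartCovDeriv_P hg hf hi hX z (mulI E (pushforward E W f p y)) (p := p)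
  have e₂ := hM.chartCovDeriv_P hg hf hi hX z (pushforward E W f p (chartP W g f p y)) (p := p)
  have z₁ : ambientForm g f p (pushforward E W f p z) (pushforward E W f p (fieldValue id p X)) = 0 := by
    rw [ambientForm_symm]
    exact hM.ambientForm_eq_zero hx hz
  have z₂ : ambientForm g f p (pushforward E W f p z)
      (mulI E (pushforward E W f p (fieldValue id p X))) = 0 := by
    rw [ambientForm_symm, ← hx'.1]
    exact hM.ambientForm_eq_zero hx'.2 hz
  have d₁ := mulI_pushforward (g := g) (f := f) (p := p) y
  have d₂ := mulI_pushforward (g := g) (f := f) (p := p) (chartP W g f p y)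
  rw [hM.chartP_chartP hy, map_smul, neg_smul] at d₂
  rw [mulI_mulI, d₁, z₁, z₂] at e₁
  rw [d₂, z₁, z₂] at e₂
  simp only [map_add, map_neg, map_smul, smul_eq_mul, hn] at e₁ e₂
  rw [map_sub, sub_apply, inducedForm_chartShape W g (hi p), inducedForm_chartShape W g (hi p),
    chartSecondForm_symm W g hf _ z, chartSecondForm_symm W g hf _ z, s₁, s₂]
  linear_combination e₁ - e₂

theorem IsPointwiseSemiSlant.inducedForm_chartShape_sub_sub
    (hM : IsPointwiseSemiSlant g f D Dθ θ) (hg : IsLCKWithLeeForm g α)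
    (hf : ContMDiff 𝓘(ℝ, W) 𝓘(ℝ, E) ∞ f)
    (hi : ∀ p, Function.Injective (pushforward E W f p))
    {X Y Z : ∀ q : M, TangentSpace 𝓘(ℝ, W) q}
    (hX : IsSection D X) (hY : IsSection Dθ Y) (hZ : IsSection Dθ Z) (p : M) :
    inducedForm W g f p
        (chartShape W g f p (chartF W g f p (fieldValue id p Y)) (chartP W g f p (fieldValue id p X))
          - chartShape W g f p (chartF W g f p (chartP W g f p (fieldValue id p Y)))
            (fieldValue id p X)) (fieldValue id p Z)
      - inducedForm W g f p
        (chartShape W g f p (chartF W g f p (fieldValue id p Z)) (chartP W g f p (fieldValue id p X))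
          - chartShape W g f p (chartF W g f p (chartP W g f p (fieldValue id p Z)))
            (fieldValue id p X)) (fieldValue id p Y)
      = -((1 - Real.cos (θ p) ^ 2) * ambientForm g f p (pushforward E W f p (fieldValue id p X))
        (pushforward E W f p (fieldValue id p (mlieBracket 𝓘(ℝ, W) Z Y)))) := by
  have hXd := mdifferentiableAt_components_id (hX.1 p)
  have hYd := mdifferentiableAt_components_id (hY.1 p)
  have hZd := mdifferentiableAt_components_id (hZ.1 p)
  -- The function g(X,B) vanishes identically, so differentiating it moves the derivative from X to
  -- B.
  have hcompat : ∀ (B : ∀ q : M, TangentSpace 𝓘(ℝ, W) q), IsSection Dθ B → ∀ u : W,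
      ambientForm g f p (chartCovDeriv W g.inner f p
            (fun q => mfderiv 𝓘(ℝ, W) 𝓘(ℝ, E) f q (X q)) u) (pushforward E W f p (fieldValue id p B))
        = - ambientForm g f p (pushforward E W f p (fieldValue id p X)) (chartCovDeriv W g.inner f p
            (fun q => mfderiv 𝓘(ℝ, W) 𝓘(ℝ, E) f q (B q)) u) := by
    intro B hB u
    have h := chartDeriv_inner W g (hf.mdifferentiable (by simp) p)
      (mdifferentiableAt_components_mfderiv (hf p) hXd)
      (mdifferentiableAt_components_mfderiv (hf p) (mdifferentiableAt_components_id (hB.1 p))) u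
    have h0 : (fun q => g.inner (f q) (mfderiv 𝓘(ℝ, W) 𝓘(ℝ, E) f q (X q))
        (mfderiv 𝓘(ℝ, W) 𝓘(ℝ, E) f q (B q))) = fun _ => (0 : ℝ) :=
      funext fun q => hM.orthogonal q _ (hX.2 q) _ (hB.2 q)
    rw [h0, chartDeriv_const, zero_apply, components_self, components_self] at h
    exact eq_neg_of_add_eq_zero_left h.symm
  have t := congrArg (ambientForm g f p (pushforward E W f p (fieldValue id p X)))
    (chartCovDeriv_sub_chartCovDeriv W g hf hZd hYd)
  rw [map_sub] at t
  rw [hM.inducedForm_chartShape_sub hg hf hi hX (hY.mem_chartDistribution p)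
      (hZ.mem_chartDistribution p),
    hM.inducedForm_chartShape_sub hg hf hi hX (hZ.mem_chartDistribution p)
      (hY.mem_chartDistribution p), hcompat Y hY, hcompat Z hZ, ← t,
    ambientForm_symm g f p (pushforward E W f p (fieldValue id p Z))]
  -- The Lee form terms are symmetric in Y and Z and cancel; the rest is the torsion identity paired
  -- with X.
  ring

end Slant

end LCK

end

/-! ### The two equivalences. -/

open LCK in
theorem theorem3p1
    {E : Type*} [NormedAddCommGroup E] [NormedSpace ℂ E] [FiniteDimensional ℂ E]
    {N : Type*} [TopologicalSpace N] [T2Space N] [ChartedSpace E N]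
    [IsManifold 𝓘(ℂ, E) ∞ N] [IsManifold 𝓘(ℝ, E) ∞ N]
    (g : ContMDiffRiemannianMetric 𝓘(ℝ, E) ∞ E (TangentSpace 𝓘(ℝ, E) : N → Type _))
    (α : ∀ x : N, TangentSpace 𝓘(ℝ, E) x →L[ℝ] ℝ)
    (hg : IsLCKWithLeeForm g α)
    {W : Type*} [NormedAddCommGroup W] [NormedSpace ℝ W] [FiniteDimensional ℝ W]
    {M : Type*} [TopologicalSpace M] [T2Space M] [ChartedSpace W M] [IsManifold 𝓘(ℝ, W) ∞ M]
    (f : M → N) (hf : Manifold.IsImmersion 𝓘(ℝ, W) 𝓘(ℝ, E) ∞ f)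
    (D Dθ : ∀ p : M, Submodule ℝ (TangentSpace 𝓘(ℝ, W) p)) (θ : M → ℝ)
    (hM : IsPointwiseSemiSlant g f D Dθ θ)
    (hθ : ∀ p, Dθ p ≠ ⊥ → Real.cos (θ p) ^ 2 < 1) :
    (IsIntegrable D ↔
      ∀ X Y : ∀ p : M, TangentSpace 𝓘(ℝ, W) p, IsSection D X → IsSection D Y → ∀ p,
        secondFundamentalForm W g f p (P g f p (Y p)) (X p)
            - secondFundamentalForm W g f p (P g f p (X p)) (Y p)
          = (2 * inducedMetric W g f p (P g f p (X p)) (Y p)) •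
              normalPart W g f p (sharp g α (f p))) ∧
    (IsIntegrable Dθ ↔
      ∀ X Z Y : ∀ p : M, TangentSpace 𝓘(ℝ, W) p,
        IsSection D X → IsSection Dθ Z → IsSection Dθ Y → ∀ p,
        inducedMetric W g f p
            (shapeOperator W g f p (F g f p (Y p)) (P g f p (X p))
              - shapeOperator W g f p (F g f p (P g f p (Y p))) (X p)) (Z p)
          = inducedMetric W g f p
            (shapeOperator W g f p (F g f p (Z p)) (P g f p (X p))
              - shapeOperator W g f p (F g f p (P g f p (Z p))) (X p)) (Y p)) := by
  have hfs : ContMDiff 𝓘(ℝ, W) 𝓘(ℝ, E) ∞ f := hf.contMDiff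
  have hi : ∀ p, Function.Injective (pushforward E W f p) := injective_mfderiv_of_isImmersion hf
  constructor
  -- The equivalence already holds for each pair of sections at each point.
  · refine forall₄_congr fun X Y hX hY => forall_congr' fun p => ?_
    refine (hM.mem_iff_chartF_eq_zero (hθ p) (hi p) _).trans ?_
    exact (Eq.congr_left (hM.chartF_mlieBracket hg hfs hi hX hY p)).trans sub_eq_zero
  · constructor
    · intro h X Z Y hX hZ hY p
      have h₁ := hM.inducedForm_chartShape_sub_sub hg hfs hi hX hY hZ p
      have h₂ : ambientForm g f p (pushforward E W f p (fieldValue id p X))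
          (pushforward E W f p (fieldValue id p (mlieBracket 𝓘(ℝ, W) Z Y))) = 0 :=
        hM.ambientForm_eq_zero (hX.mem_chartDistribution p) (h Z Y hZ hY p)
      rw [h₂, mul_zero, neg_zero] at h₁
      exact sub_eq_zero.1 h₁
    · intro h Z Y hZ hY p
      -- Where `Dθ p` is zero, cos²θ may equal 1 and the factor sin²θ cannot be cancelled. There
      -- both sections vanish at `p`, hence so does their bracket.
      by_cases hbot : Dθ p = ⊥
      · have h0 : ∀ B, IsSection Dθ B → B p = 0 := fun B hB =>
          (Submodule.mem_bot ℝ).1 (hbot ▸ hB.2 p)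
        have hzero : mlieBracket 𝓘(ℝ, W) Z Y p = 0 := by
          rw [← mlieBracketWithin_univ]
          exact mlieBracketWithin_eq_zero_of_eq_zero (h0 Z hZ) (h0 Y hY)
        rw [hzero]
        exact (Dθ p).zero_mem
      · refine (hM.mem_slant_iff (hi p) _).2 fun x hx => ?_
        obtain ⟨X, hX, rfl⟩ := exists_isSection_eq hM.smooth_holomorphic hx
        have h₁ := hM.inducedForm_chartShape_sub_sub hg hfs hi hX hY hZ p
        have h₂ := h₁.symm.trans (sub_eq_zero.2 (h X Z Y hX hZ hY p))
        exact (mul_eq_zero.1 (neg_eq_zero.1 h₂)).resolve_left (sub_pos.2 (hθ p hbot)).ne'
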